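/- Let $C\subset\mathbb{CP}^2$ be a smooth cubic curve given by a homogeneous cubic equation with real coefficients in the homogeneous coordinates $(z_1:z_2:z_3)$, and assume that $C$ meets the line at infinity $\{z_3=0\}$ in three distinct real points $\infty_1,\infty_2,\infty_3$. Let $C_{\mathbb R}=C\cap\mathbb{RP}^2$ be its real part. The connected components of $C_{\mathbb R}$ are called ovals; an oval is bounded if it does not meet the line at infinity, and unbounded otherwise. A hexagon regularly inscribed in $C$ consists of six points $P_1,Q_2,P_3,Q_1,P_2,Q_3\in C_{\mathbb R}$, not necessarily distinct, such that for every permutation $(i,j,k)$ of $(1,2,3)$ the third intersection point (counted with multiplicity) of $C$ with the line $P_iQ_j$ is $\infty_k$; here $P_iQ_j$ means the tangent line to $C$ at $P_i$ if $P_i=Q_j$. The hexagon has type $(m,n)$ if $C_{\mathbb R}$ has exactly two ovals, one of them contractible in $\mathbb{RP}^2$ (its inclusion in $\mathbb{RP}^2$ is null-homotopic) and the other one not, and $m$ of the six vertices lie on the contractible oval and $n$ of them on the non-contractible one (vertices are counted as labelled points, so coinciding vertices are counted separately). Let $H$ be a hexagon regularly inscribed in $C$. 1. If one of the ovals of $C_{\mathbb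 R}$ is bounded, then $H$ has type $(0,6)$ or $(6,0)$. 2. If $C_{\mathbb R}$ has exactly two ovals and both are unbounded, then $H$ has type $(4,2)$ or $(2,4)$. -/

import Mathlib

/-- The real projective plane, with homogeneous coordinates `(z₁ : z₂ : z₃)` indexed by `0, 1, 2`. -/
abbrev RP2 : Type := Projectivization ℝ (Fin 3 → ℝ)

/-- The quotient topology from `ℝ³ \ {0}`. -/
noncomputable instance RP2.instTopologicalSpace : TopologicalSpace RP2 :=
  TopologicalSpace.coinduced
    (fun v : {v : Fin 3 → ℝ // v ≠ 0} => Projectivization.mk ℝ v.1 v.2) inferInstance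

/-- The line at infinity `z₃ = 0`. -/
def lineAtInfinity : Set RP2 := {p | ∀ v ∈ p.submodule, v 2 = 0}

/-- The set of real points of the projective curve `F = 0` (used for homogeneous `F` of degree 3). -/
def realPoints (F : MvPolynomial (Fin 3) ℝ) : Set RP2 :=
  {p | ∀ v ∈ p.submodule, MvPolynomial.eval v F = 0}

/-- `F` is the equation of a smooth real cubic curve in the complex projective plane: `F` is a
ternary cubic form with real coefficients, and the curve `F = 0` in `ℂℙ²` has no singular point. -/
structure IsSmoothRealCubic (F : MvPolynomial (Fin 3) ℝ) : Prop where
  homogeneous : F.IsHomogeneous 3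
  smooth : ∀ z : Fin 3 → ℂ, z ≠ 0 → MvPolynomial.aeval z F = 0 →
    ∃ i, MvPolynomial.aeval z (MvPolynomial.pderiv i F) ≠ 0

/-- The ovals of the curve: the connected components of its real part. -/
def ovals (F : MvPolynomial (Fin 3) ℝ) : Set (Set RP2) :=
  {O | ∃ p ∈ realPoints F, O = connectedComponentIn (realPoints F) p}

/-- An oval is bounded if it does not meet the line at infinity. -/
def IsBoundedOval (O : Set RP2) : Prop := Disjoint O lineAtInfinity

/-- `O` is contractible in `ℝℙ²`: its inclusion is homotopic to a constant map. -/
def IsContractibleInRP2 (O : Set RP2) : Prop :=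
  (⟨Subtype.val, continuous_subtype_val⟩ : C(O, RP2)).Nullhomotopic

/-- Some line meets the cubic `F = 0` exactly in the points `p`, `q`, `r`, counted with
multiplicity. The line is parametrized by `(s : t) ↦ s u + t v`; the three points have
parameters `(a m : b m)`, and the restriction of `F` to the line is, up to a nonzero constant,
the product of the three linear forms that vanish at these parameters. So for `p ≠ q` the line is
the line `pq`, for `p = q` it is the tangent line at `p`, and `r` is its third intersection
point with the curve. -/
def LineMeetsIn (F : MvPolynomial (Fin 3) ℝ) (p q r : RP2) : Prop :=
  ∃ u v : Fin 3 → ℝ, LinearIndependent ℝ ![u, v] ∧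
    ∃ a b : Fin 3 → ℝ,
      (∀ m, ∃ h : a m • u + b m • v ≠ 0,
        (![p, q, r] : Fin 3 → RP2) m = Projectivization.mk ℝ (a m • u + b m • v) h) ∧
      ∃ c : ℝ, c ≠ 0 ∧ ∀ s t : ℝ,
        MvPolynomial.eval (s • u + t • v) F = c * ∏ m, (s * b m - t * a m)

/-- The hexagon `P₁ Q₂ P₃ Q₁ P₂ Q₃` is regularly inscribed in the cubic `F = 0`, whose points at
infinity are `inf 0`, `inf 1`, `inf 2`. -/
structure IsRegularlyInscribed (F : MvPolynomial (Fin 3) ℝ) (inf P Q : Fin 3 → RP2) : Prop where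
  mem_P : ∀ i, P i ∈ realPoints F
  mem_Q : ∀ i, Q i ∈ realPoints F
  third : ∀ σ : Equiv.Perm (Fin 3), LineMeetsIn F (P (σ 0)) (Q (σ 1)) (inf (σ 2))

/-- The number of the six vertices that lie on `O` (coinciding vertices are counted separately). -/
noncomputable def vertexCount (P Q : Fin 3 → RP2) (O : Set RP2) : ℕ :=
  {i | P i ∈ O}.ncard + {i | Q i ∈ O}.ncard

/-- The curve `F = 0` has exactly two ovals, just one of them is contractible in `ℝℙ²`, and `m` of
the six vertices lie on the contractible oval and `n` of them on the non-contractible one. -/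
def HasType (F : MvPolynomial (Fin 3) ℝ) (P Q : Fin 3 → RP2) (m n : ℕ) : Prop :=
  ∃ O₁ O₂ : Set RP2, ovals F = {O₁, O₂} ∧
    IsContractibleInRP2 O₁ ∧ ¬ IsContractibleInRP2 O₂ ∧
    vertexCount P Q O₁ = m ∧ vertexCount P Q O₂ = n

/-!
The proof rests on the description of the real points of a smooth cubic: they are connected, or they
split into an oval `A` that is contractible in `ℝℙ²` and an oval `B` that is not, and in the second
case a line with three real intersection points meets `A` in an even number of them
(`IsSmoothRealCubic.isPreconnected_or_splitting`). Granted this, the theorem is a count. Two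
vertices `P i`, `Q j` are collinear with the point at infinity `inf l`, so they lie on the same oval
if and only if `inf l ∈ B`. The three points at infinity are collinear themselves, so none or two of
them lie on `A`. If none does, all six vertices lie on one oval. If two do, the vertices are
distributed as `4 + 2`. A bounded oval must be `A`, by parity; if both ovals are unbounded, `A`
contains a point at infinity.

To describe the real points, let `T` be a real point and project from the residual intersection
point `p₀` of the tangent line at `T`. The points of the curve on a line through `p₀` are given by a
quadratic equation whose discriminant is a binary quartic. Smoothness makes its real zeros simple,
and the direction of `T` (or of the flex tangent, if `T` is a flex) is one of them, so the
discriminant is negative somewhere. Sending a direction where it is negative to `y = 0` leads to the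
normal form `x z² + 2 q y² z + K(x, y)` (`IsSmoothRealCubic.exists_normalForm`). In the affine chart
`y = 1` the discriminant is a quartic in `x` with negative leading coefficient and simple real
roots, so it is nonnegative on one or two compact intervals. The interval that contains `0` carries,
together with `p₀`, the oval `B`; the other interval, if there is one, carries `A`.

Each oval is the union of two explicit arcs with common ends. `A` lies in the chart `y ≠ 0`, hence
is contractible. A null-homotopy of the inclusion of a compact set lifts to `ℝ³ \ {0}`
(`exists_isLift_of_nullhomotopic`), and going around `B` changes the sign of the homogeneous
coordinates, so `B` is not contractible. The parity statement (`gapSign_parity`) compares the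
intersection of a line with two lines through `p₀` that separate the directions of `A` from those of
`B`.
-/

section
open MvPolynomial Matrix
open scoped Topology

/-! ### Ternary cubic forms and linear changes of coordinates -/

/-- The ternary cubic form `K(x, y) + 2 Q(x, y) z + L(x, y) z² + n z³`, sorted by powers of `z`; the
entries of `k`, `q`, `l` are the coefficients of `K`, `Q`, `L` by falling powers of `x`. -/
noncomputable def ternaryCubic (k : Fin 4 → ℝ) (q : Fin 3 → ℝ) (l : Fin 2 → ℝ) (n : ℝ) :
    MvPolynomial (Fin 3) ℝ :=
  C (k 0) * X 0 ^ 3 + C (k 1) * X 0 ^ 2 * X 1 + C (k 2) * X 0 * X 1 ^ 2 + C (k 3) * X 1 ^ 3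
    + 2 * (C (q 0) * X 0 ^ 2 + C (q 1) * X 0 * X 1 + C (q 2) * X 1 ^ 2) * X 2
    + (C (l 0) * X 0 + C (l 1) * X 1) * X 2 ^ 2 + C n * X 2 ^ 3

theorem eval_ternaryCubic (k : Fin 4 → ℝ) (q : Fin 3 → ℝ) (l : Fin 2 → ℝ) (n : ℝ)
    (v : Fin 3 → ℝ) : eval v (ternaryCubic k q l n) =
      k 0 * v 0 ^ 3 + k 1 * v 0 ^ 2 * v 1 + k 2 * v 0 * v 1 ^ 2 + k 3 * v 1 ^ 3
      + 2 * (q 0 * v 0 ^ 2 + q 1 * v 0 * v 1 + q 2 * v 1 ^ 2) * v 2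
      + (l 0 * v 0 + l 1 * v 1) * v 2 ^ 2 + n * v 2 ^ 3 := by
  simp [ternaryCubic]

theorem exists_eq_ternaryCubic {G : MvPolynomial (Fin 3) ℝ} (hG : G.IsHomogeneous 3) :
    ∃ k q l n, G = ternaryCubic k q l n := by
  rw [G.as_sum]
  refine Finset.sum_induction _ (fun G => ∃ k q l n, G = ternaryCubic k q l n) ?_ ?_ ?_
  · rintro _ _ ⟨k, q, l, n, rfl⟩ ⟨k', q', l', n', rfl⟩
    refine ⟨k + k', q + q', l + l', n + n', ?_⟩
    simp only [ternaryCubic, Pi.add_apply, C_add]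
    ring
  · exact ⟨0, 0, 0, 0, by simp [ternaryCubic]⟩
  · intro d hd
    have h3 : d.degree = 3 := by
      have := hG (mem_support_iff.1 hd)
      rw [Finsupp.degree_eq_weight_one]
      exact this
    have hm : monomial d (coeff d G) = C (coeff d G) * (X 0 ^ d 0 * X 1 ^ d 1 * X 2 ^ d 2) := by
      rw [monomial_eq, Finsupp.prod_fintype _ _ (by simp), Fin.prod_univ_three]
    rw [hm]
    generalize coeff d G = c
    rw [Finsupp.degree_eq_sum, Fin.sum_univ_three] at h3
    have hc : (C c : MvPolynomial (Fin 3) ℝ) = 2 * C (c / 2) := by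
      rw [← map_ofNat C 2, ← C_mul]
      congr 1
      ring
    obtain h | h | h | h : d 2 = 0 ∨ d 2 = 1 ∨ d 2 = 2 ∨ d 2 = 3 := by omega
    · obtain h' | h' | h' | h' : d 1 = 0 ∨ d 1 = 1 ∨ d 1 = 2 ∨ d 1 = 3 := by omega
      · refine ⟨![c, 0, 0, 0], 0, 0, 0, ?_⟩
        simp [ternaryCubic, h, h', show d 0 = 3 by omega]
      · refine ⟨![0, c, 0, 0], 0, 0, 0, ?_⟩
        simp [ternaryCubic, h, h', show d 0 = 2 by omega, mul_assoc]
      · refine ⟨![0, 0, c, 0], 0, 0, 0, ?_⟩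
        simp [ternaryCubic, h, h', show d 0 = 1 by omega, mul_assoc]
      · refine ⟨![0, 0, 0, c], 0, 0, 0, ?_⟩
        simp [ternaryCubic, h, h', show d 0 = 0 by omega]
    · obtain h' | h' | h' : d 1 = 0 ∨ d 1 = 1 ∨ d 1 = 2 := by omega
      · refine ⟨0, ![c / 2, 0, 0], 0, 0, ?_⟩
        rw [hc]
        simp [ternaryCubic, h, h', show d 0 = 2 by omega, mul_assoc]
      · refine ⟨0, ![0, c / 2, 0], 0, 0, ?_⟩
        rw [hc]
        simp [ternaryCubic, h, h', show d 0 = 1 by omega, mul_assoc]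
      · refine ⟨0, ![0, 0, c / 2], 0, 0, ?_⟩
        rw [hc]
        simp [ternaryCubic, h, h', show d 0 = 0 by omega, mul_assoc]
    · obtain h' | h' : d 1 = 0 ∨ d 1 = 1 := by omega
      · refine ⟨0, 0, ![c, 0], 0, ?_⟩
        simp [ternaryCubic, h, h', show d 0 = 1 by omega, mul_assoc]
      · refine ⟨0, 0, ![0, c], 0, ?_⟩
        simp [ternaryCubic, h, h', show d 0 = 0 by omega, mul_assoc]
    · refine ⟨0, 0, 0, c, ?_⟩
      simp [ternaryCubic, h, show d 1 = 0 by omega, show d 0 = 0 by omega]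

/-- A smooth cubic has no nontrivial common zero of its three partial derivatives; by Euler's
identity such a zero would lie on the curve. -/
theorem IsSmoothRealCubic.no_singular {k : Fin 4 → ℝ} {q : Fin 3 → ℝ} {l : Fin 2 → ℝ} {n : ℝ}
    (h : IsSmoothRealCubic (ternaryCubic k q l n)) {x y z : ℂ}
    (hx : 3 * k 0 * x ^ 2 + 2 * k 1 * x * y + k 2 * y ^ 2
      + 2 * (2 * q 0 * x + q 1 * y) * z + l 0 * z ^ 2 = 0)
    (hy : k 1 * x ^ 2 + 2 * k 2 * x * y + 3 * k 3 * y ^ 2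
      + 2 * (q 1 * x + 2 * q 2 * y) * z + l 1 * z ^ 2 = 0)
    (hz : 2 * (q 0 * x ^ 2 + q 1 * x * y + q 2 * y ^ 2) + 2 * (l 0 * x + l 1 * y) * z
      + 3 * n * z ^ 2 = 0) : x = 0 ∧ y = 0 ∧ z = 0 := by
  by_contra hne
  have hv : (![x, y, z] : Fin 3 → ℂ) ≠ 0 := by
    intro h0
    exact hne ⟨congrFun h0 0, congrFun h0 1, congrFun h0 2⟩
  obtain ⟨i, hi⟩ := h.smooth ![x, y, z] hv (by
    simp [ternaryCubic]
    linear_combination (x * hx + y * hy + z * hz) / 3)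
  have h2 (j : Fin 3) : pderiv j (2 : MvPolynomial (Fin 3) ℝ) = 0 := Derivation.map_natCast _ 2
  apply hi
  fin_cases i
  · simp [ternaryCubic, pderiv_X, h2]
    linear_combination hx
  · simp [ternaryCubic, pderiv_X, h2]
    linear_combination hy
  · simp [ternaryCubic, pderiv_X, h2]
    linear_combination hz

/-- The polynomial `v ↦ F (M v)`. -/
noncomputable def linSubst (M : Matrix (Fin 3) (Fin 3) ℝ) (F : MvPolynomial (Fin 3) ℝ) :
    MvPolynomial (Fin 3) ℝ :=
  aeval (fun i => ∑ j, C (M i j) * X j) F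

theorem aeval_linSubst {S : Type*} [CommRing S] [Algebra ℝ S] (M : Matrix (Fin 3) (Fin 3) ℝ)
    (F : MvPolynomial (Fin 3) ℝ) (z : Fin 3 → S) :
    aeval z (linSubst M F) = aeval (M.map (algebraMap ℝ S) *ᵥ z) F := by
  unfold linSubst
  rw [← AlgHom.comp_apply, comp_aeval]
  congr 2
  funext i
  simp [Matrix.mulVec, dotProduct]

theorem eval_linSubst (M : Matrix (Fin 3) (Fin 3) ℝ)
    (F : MvPolynomial (Fin 3) ℝ) (z : Fin 3 → ℝ) :
    eval z (linSubst M F) = eval (M *ᵥ z) F := by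
  have := aeval_linSubst M F z
  simpa [aeval_eq_eval] using this

/-- The chain rule for linear substitutions. -/
theorem pderiv_linSubst (M : Matrix (Fin 3) (Fin 3) ℝ) (F : MvPolynomial (Fin 3) ℝ) (j : Fin 3) :
    pderiv j (linSubst M F) = ∑ i, C (M i j) * linSubst M (pderiv i F) := by
  unfold linSubst
  induction F using MvPolynomial.induction_on with
  | C a => simp
  | add p q hp hq => simp only [map_add, hp, hq, mul_add, Finset.sum_add_distrib]
  | mul_X p i hp =>
    simp only [map_mul, Derivation.leibniz, hp, smul_eq_mul, map_add, mul_add,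
      Finset.sum_add_distrib, aeval_X, pderiv_X, map_sum, Finset.mul_sum]
    fin_cases i <;> fin_cases j <;>
      simp [Fin.sum_univ_three] <;> ring

theorem IsSmoothRealCubic.comp_linSubst {F : MvPolynomial (Fin 3) ℝ} (hF : IsSmoothRealCubic F)
    {M : Matrix (Fin 3) (Fin 3) ℝ} (hM : M.det ≠ 0) : IsSmoothRealCubic (linSubst M F) := by
  have hMC : IsUnit (M.map (algebraMap ℝ ℂ)) := by
    rw [Matrix.isUnit_iff_isUnit_det, isUnit_iff_ne_zero, ← RingHom.mapMatrix_apply,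
      ← RingHom.map_det]
    simpa using hM
  refine ⟨?_, ?_⟩
  · have := hF.homogeneous.aeval (fun i => ∑ j, C (M i j) * X j) (n := 1) (fun i =>
      IsHomogeneous.sum _ _ _ fun j _ => by
        simpa using (isHomogeneous_C (Fin 3) (M i j)).mul (isHomogeneous_X ℝ j))
    exact this
  · intro z hz h0
    by_contra! hs
    rw [aeval_linSubst] at h0
    obtain ⟨i, hi⟩ := hF.smooth _ (fun h => hz ((Matrix.mulVec_injective_of_isUnit hMC)
      (by simpa using h))) h0
    have hT : IsUnit (M.map (algebraMap ℝ ℂ)).transpose := by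
      rwa [Matrix.isUnit_transpose]
    have := (Matrix.mulVec_injective_of_isUnit hT) (a₁ := fun i =>
      aeval (M.map (algebraMap ℝ ℂ) *ᵥ z) (pderiv i F)) (a₂ := 0) (by
        funext j
        have := hs j
        rw [pderiv_linSubst] at this
        simpa [Matrix.mulVec, dotProduct, aeval_linSubst] using this)
    exact hi (congrFun this i)

/-! ### The normal form at the residual point of a tangent -/

theorem linSubst_linSubst (M N : Matrix (Fin 3) (Fin 3) ℝ) (F : MvPolynomial (Fin 3) ℝ) :
    linSubst N (linSubst M F) = linSubst (M * N) F := by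
  refine MvPolynomial.funext fun v => ?_
  simp only [eval_linSubst, Matrix.mulVec_mulVec]

/-- A smooth cubic does not contain the line `z = 0`: the line would meet the residual conic in a
singular point. That point may be complex, so smoothness of the real part would not be enough. -/
theorem IsSmoothRealCubic.restrict_ne_zero {k : Fin 4 → ℝ} {q : Fin 3 → ℝ} {l : Fin 2 → ℝ} {n : ℝ}
    (h : IsSmoothRealCubic (ternaryCubic k q l n)) : k ≠ 0 := by
  rintro rfl
  by_cases h0 : q 0 = 0
  · have := h.no_singular (x := 1) (y := 0) (z := 0) (by simp) (by simp) (by simp [h0])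
    simp at this
  · obtain ⟨x, hx⟩ := exists_quadratic_eq_zero (a := (q 0 : ℂ)) (b := q 1) (c := q 2)
      (by exact_mod_cast h0) (by
        obtain ⟨s, hs⟩ := IsAlgClosed.exists_pow_nat_eq (discrim (q 0 : ℂ) (q 1) (q 2))
          (n := 2) (by norm_num)
        exact ⟨s, by rw [← hs, sq]⟩)
    have := h.no_singular (x := x) (y := 1) (z := 0) (by simp) (by simp) (by
      simp; linear_combination hx)
    simp at this

theorem exists_det_ne_zero_mulVec_eq {T : Fin 3 → ℝ} (hT : T ≠ 0) :
    ∃ M : Matrix (Fin 3) (Fin 3) ℝ, M.det ≠ 0 ∧ M *ᵥ ![1, 0, 0] = T := by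
  have h : T 0 ≠ 0 ∨ T 1 ≠ 0 ∨ T 2 ≠ 0 := by
    by_contra! h
    exact hT (by ext i; fin_cases i <;> simp [h])
  obtain h | h | h := h
  · refine ⟨!![T 0, 0, 0; T 1, 1, 0; T 2, 0, 1], by simpa [det_fin_three] using h, ?_⟩
    ext i; fin_cases i <;> simp
  · refine ⟨!![T 0, 1, 0; T 1, 0, 0; T 2, 0, 1], by simpa [det_fin_three] using h, ?_⟩
    ext i; fin_cases i <;> simp
  · refine ⟨!![T 0, 1, 0; T 1, 0, 1; T 2, 0, 0], by simpa [det_fin_three] using h, ?_⟩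
    ext i; fin_cases i <;> simp

theorem eval_linSubst_vec (M : Matrix (Fin 3) (Fin 3) ℝ) (k : Fin 4 → ℝ) (q : Fin 3 → ℝ)
    (l : Fin 2 → ℝ) (n : ℝ) {k' : Fin 4 → ℝ} {q' : Fin 3 → ℝ}
    {l' : Fin 2 → ℝ} {n' : ℝ} (h : linSubst M (ternaryCubic k q l n) = ternaryCubic k' q' l' n')
    (x y z : ℝ) :
    k' 0 * x ^ 3 + k' 1 * x ^ 2 * y + k' 2 * x * y ^ 2 + k' 3 * y ^ 3
      + 2 * (q' 0 * x ^ 2 + q' 1 * x * y + q' 2 * y ^ 2) * z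
      + (l' 0 * x + l' 1 * y) * z ^ 2 + n' * z ^ 3 =
      eval (M *ᵥ ![x, y, z]) (ternaryCubic k q l n) := by
  rw [← eval_linSubst, h, eval_ternaryCubic]
  simp

/-- Coordinates in which a given real point is `(1 : 0 : 0)` with tangent line `z = 0`. -/
theorem IsSmoothRealCubic.exists_tangent {F : MvPolynomial (Fin 3) ℝ} (hF : IsSmoothRealCubic F)
    {T : Fin 3 → ℝ} (hT0 : T ≠ 0) (hT : eval T F = 0) :
    ∃ M : Matrix (Fin 3) (Fin 3) ℝ, M.det ≠ 0 ∧ ∃ k q l n,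
      linSubst M F = ternaryCubic k q l n ∧ k 0 = 0 ∧ k 1 = 0 := by
  obtain ⟨M, hM, rfl⟩ := exists_det_ne_zero_mulVec_eq hT0
  have h1 := hF.comp_linSubst hM
  obtain ⟨k, q, l, n, hG⟩ := exists_eq_ternaryCubic h1.homogeneous
  rw [hG] at h1
  rw [← eval_linSubst, hG, eval_ternaryCubic] at hT
  have hk0 : k 0 = 0 := by simpa using hT
  have hpos : 0 < 4 * q 0 ^ 2 + k 1 ^ 2 := by
    by_contra! hle
    have hq0 : q 0 = 0 := by nlinarith [sq_nonneg (q 0), sq_nonneg (k 1)]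
    have hk1 : k 1 = 0 := by nlinarith [sq_nonneg (q 0), sq_nonneg (k 1)]
    have := h1.no_singular (x := 1) (y := 0) (z := 0) (by simp [hk0]) (by simp [hk1])
      (by simp [hq0])
    simp at this
  have hN : (!![1, 0, 0; 0, 2 * q 0, k 1; 0, -k 1, 2 * q 0] : Matrix (Fin 3) (Fin 3) ℝ).det
      ≠ 0 := by
    simp [det_fin_three]
    nlinarith
  refine ⟨M * !![1, 0, 0; 0, 2 * q 0, k 1; 0, -k 1, 2 * q 0], ?_, ?_⟩
  · rw [det_mul]
    exact mul_ne_zero hM hN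
  obtain ⟨k', q', l', n', hG'⟩ := exists_eq_ternaryCubic (h1.comp_linSubst hN).homogeneous
  refine ⟨k', q', l', n', by rw [← linSubst_linSubst, hG, hG'], ?_⟩
  have e (y : ℝ) := eval_linSubst_vec _ _ _ _ _ hG' 1 y 0
  simp only [eval_ternaryCubic] at e
  have e0 := e 0
  have e1 := e 1
  have e2 := e (-1)
  have e3 := e 2
  simp [hk0] at e0 e1 e2 e3
  exact ⟨e0, by linarith⟩

/-- Take `(0 : 0 : 1)` to be the residual intersection point of the curve with the tangent line at a
point `T`. The direction of `T` (of the tangent line itself, if `T` is a flex) is a zero of the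
discriminant `Q² - L K` of the projection from `(0 : 0 : 1)`; in the coordinates found here it is
`(1, 0)`. The two alternatives at the end are `T` an ordinary point and `T` a flex. -/
theorem IsSmoothRealCubic.exists_discrim_root {F : MvPolynomial (Fin 3) ℝ}
    (hF : IsSmoothRealCubic F) {T : Fin 3 → ℝ} (hT0 : T ≠ 0) (hT : eval T F = 0) :
    ∃ M : Matrix (Fin 3) (Fin 3) ℝ, M.det ≠ 0 ∧ ∃ k q l,
      linSubst M F = ternaryCubic k q l 0 ∧ q 0 = 0 ∧ (k 0 = 0 ∧ l 0 ≠ 0 ∨ k 0 ≠ 0 ∧ l 0 = 0) := by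
  obtain ⟨M, hM, k, q, l, n, hG, hk0, hk1⟩ := hF.exists_tangent hT0 hT
  have h1 := hF.comp_linSubst hM
  rw [hG] at h1
  have hk := h1.restrict_ne_zero
  by_cases hk2 : k 2 = 0
  · have hk3 : k 3 ≠ 0 := fun hk3 => hk (by ext i; fin_cases i <;> simp [*])
    have hN : (!![0, 0, 1; 1, 0, 0; 0, 1, 0] : Matrix (Fin 3) (Fin 3) ℝ).det ≠ 0 := by
      simp [det_fin_three]
    refine ⟨M * !![0, 0, 1; 1, 0, 0; 0, 1, 0], by rw [det_mul]; exact mul_ne_zero hM hN, ?_⟩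
    obtain ⟨k', q', l', n', hG'⟩ := exists_eq_ternaryCubic (h1.comp_linSubst hN).homogeneous
    have e (x z : ℝ) := eval_linSubst_vec _ _ _ _ _ hG' x 0 z
    simp only [eval_ternaryCubic] at e
    have e0 := e 1 0
    have e1 := e 0 1
    have e2 := e 1 1
    have e3 := e 1 (-1)
    simp [hk0, hk1, hk2] at e0 e1 e2 e3
    refine ⟨k', q', l', by rw [← linSubst_linSubst, hG, hG', e1], by linarith, .inr ⟨?_, ?_⟩⟩
    · rwa [e0]
    · linarith
  · have hN : (!![1, 0, k 3; 0, 0, -k 2; 0, 1, 0] : Matrix (Fin 3) (Fin 3) ℝ).det ≠ 0 := by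
      simpa [det_fin_three] using hk2
    refine ⟨M * !![1, 0, k 3; 0, 0, -k 2; 0, 1, 0],
      by rw [det_mul]; exact mul_ne_zero hM hN, ?_⟩
    obtain ⟨k', q', l', n', hG'⟩ := exists_eq_ternaryCubic (h1.comp_linSubst hN).homogeneous
    have e (x z : ℝ) := eval_linSubst_vec _ _ _ _ _ hG' x 0 z
    simp only [eval_ternaryCubic] at e
    have e0 := e 1 0
    have e1 := e 0 1
    have e2 := e 1 1
    have e3 := e 1 (-1)
    simp [hk0, hk1] at e0 e1 e2 e3
    have hn : n' = 0 := by linear_combination e1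
    refine ⟨k', q', l', by rw [← linSubst_linSubst, hG, hG', hn], by linarith, .inl ⟨e0, ?_⟩⟩
    have : l' 0 = k 2 ^ 3 := by linarith
    rw [this]
    positivity

/-- By smoothness the zero `(1, 0)` of `Q² - L K` is simple, so the quartic takes negative values:
some line through `(0 : 0 : 1)` meets the curve in no other real point. -/
theorem IsSmoothRealCubic.exists_discrim_neg {k : Fin 4 → ℝ} {q : Fin 3 → ℝ} {l : Fin 2 → ℝ}
    (h : IsSmoothRealCubic (ternaryCubic k q l 0)) (hq : q 0 = 0)
    (hkl : k 0 = 0 ∧ l 0 ≠ 0 ∨ k 0 ≠ 0 ∧ l 0 = 0) :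
    ∃ t : ℝ, (q 0 + q 1 * t + q 2 * t ^ 2) ^ 2 <
      (l 0 + l 1 * t) * (k 0 + k 1 * t + k 2 * t ^ 2 + k 3 * t ^ 3) := by
  have hd : l 0 * k 1 + l 1 * k 0 ≠ 0 := by
    obtain ⟨hk, hl⟩ | ⟨hk, hl⟩ := hkl
    · intro h0
      have hk1 : k 1 = 0 := by simpa [hk, hl] using h0
      have := h.no_singular (x := 1) (y := 0) (z := 0) (by simp [hk]) (by simp [hk1])
        (by simp [hq])
      simp at this
    · intro h0
      have hl1 : l 1 = 0 := by simpa [hk, hl] using h0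
      have := h.no_singular (x := 0) (y := 0) (z := 1) (by simp [hl]) (by simp [hl1])
        (by simp)
      simp at this
  by_contra! hle
  have hmul : l 0 * k 0 = 0 := by obtain ⟨hk, -⟩ | ⟨-, hl⟩ := hkl <;> simp [*]
  let D : Polynomial ℝ := (.C (q 0) + .C (q 1) * .X + .C (q 2) * .X ^ 2) ^ 2 -
    (.C (l 0) + .C (l 1) * .X) * (.C (k 0) + .C (k 1) * .X + .C (k 2) * .X ^ 2 + .C (k 3) * .X ^ 3)
  have hmin : IsLocalMin (fun t => D.eval t) 0 := by
    refine Filter.Eventually.of_forall fun t => ?_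
    simp [D, hq, hmul]
    have := hle t
    rw [hq] at this
    linarith
  have := hmin.hasDerivAt_eq_zero (D.hasDerivAt 0)
  simp [D, hq, Polynomial.derivative_pow] at this
  apply hd
  linarith

/-- The normal form `x z² + 2 q y² z + K(x, y)` of a smooth cubic with a real point. The line
`y = 0` meets it only in the real point `(0 : 0 : 1)`, because the coefficient of `x³` is
positive, and `x = 0` is the tangent line at that point. -/
theorem IsSmoothRealCubic.exists_normalForm {F : MvPolynomial (Fin 3) ℝ}
    (hF : IsSmoothRealCubic F) {T : Fin 3 → ℝ} (hT0 : T ≠ 0) (hT : eval T F = 0) :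
    ∃ M : Matrix (Fin 3) (Fin 3) ℝ, M.det ≠ 0 ∧ ∃ k : Fin 4 → ℝ, ∃ q : ℝ, 0 < k 0 ∧ 0 ≤ q ∧
      linSubst M F = ternaryCubic k ![0, 0, q] ![1, 0] 0 := by
  obtain ⟨M, hM, k, q, l, hG, hq, hkl⟩ := hF.exists_discrim_root hT0 hT
  have h1 := hF.comp_linSubst hM
  rw [hG] at h1
  obtain ⟨t, ht⟩ := h1.exists_discrim_neg hq hkl
  set c := l 0 + l 1 * t with hc
  have hc0 : c ≠ 0 := by
    intro h
    rw [h] at ht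
    nlinarith [sq_nonneg (q 0 + q 1 * t + q 2 * t ^ 2)]
  -- the coefficients of `Q` in the new basis
  set Q0 := (q 0 + q 1 * t + q 2 * t ^ 2) / c ^ 2 with hQ0
  set Q1 := (2 * q 0 * l 1 + q 1 * (t * l 1 - l 0) - 2 * q 2 * t * l 0) / c with hQ1
  set Q2 := q 0 * l 1 ^ 2 - q 1 * l 0 * l 1 + q 2 * l 0 ^ 2 with hQ2
  have key (ε : ℝ) (hε : ε ^ 2 = 1) : ∃ N : Matrix (Fin 3) (Fin 3) ℝ, N.det ≠ 0 ∧
      ∃ k' : Fin 4 → ℝ, 0 < k' 0 ∧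
        linSubst N (ternaryCubic k q l 0) = ternaryCubic k' ![0, 0, ε * Q2] ![1, 0] 0 := by
    have hε0 : ε ≠ 0 := by rintro rfl; simp at hε
    refine ⟨!![1 / c, l 1, 0; t / c, -l 0, 0; -Q0, -Q1, ε], ?_,
      ![(k 0 + k 1 * t + k 2 * t ^ 2 + k 3 * t ^ 3) / c ^ 3 - Q0 ^ 2,
        (3 * k 0 * l 1 + k 1 * (2 * t * l 1 - l 0) + k 2 * (t ^ 2 * l 1 - 2 * t * l 0)
          - 3 * k 3 * t ^ 2 * l 0) / c ^ 2 - 2 * Q0 * Q1,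
        (3 * k 0 * l 1 ^ 2 + k 1 * (t * l 1 ^ 2 - 2 * l 0 * l 1) +
          k 2 * (l 0 ^ 2 - 2 * t * l 0 * l 1) + 3 * k 3 * t * l 0 ^ 2) / c
          - Q1 ^ 2 - 2 * Q0 * Q2,
        k 0 * l 1 ^ 3 - k 1 * l 1 ^ 2 * l 0 + k 2 * l 1 * l 0 ^ 2 - k 3 * l 0 ^ 3
          - 2 * Q2 * Q1], ?_, ?_⟩
    · have : (!![1 / c, l 1, 0; t / c, -l 0, 0; -Q0, -Q1, ε] : Matrix (Fin 3) (Fin 3) ℝ).det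
          = -ε := by
        simp [det_fin_three]
        field_simp
        rw [hc]
        ring
      rw [this]
      simpa using hε0
    · simp only [cons_val_zero]
      have : (k 0 + k 1 * t + k 2 * t ^ 2 + k 3 * t ^ 3) / c ^ 3 - Q0 ^ 2 =
          (c * (k 0 + k 1 * t + k 2 * t ^ 2 + k 3 * t ^ 3) -
            (q 0 + q 1 * t + q 2 * t ^ 2) ^ 2) / c ^ 4 := by
        rw [hQ0]; field_simp
      rw [this]
      have : 0 < c ^ 4 := by positivity
      apply div_pos _ this
      linarith
    · refine MvPolynomial.funext fun v => ?_
      rw [eval_linSubst, eval_ternaryCubic, eval_ternaryCubic]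
      have hv0 : (!![1 / c, l 1, 0; t / c, -l 0, 0; -Q0, -Q1, ε] *ᵥ v) 0 =
        v 0 / c + l 1 * v 1 := by simp [mulVec, dotProduct, Fin.sum_univ_three]; ring
      have hv1 : (!![1 / c, l 1, 0; t / c, -l 0, 0; -Q0, -Q1, ε] *ᵥ v) 1 =
        t * v 0 / c - l 0 * v 1 := by simp [mulVec, dotProduct, Fin.sum_univ_three]; ring
      have hv2 : (!![1 / c, l 1, 0; t / c, -l 0, 0; -Q0, -Q1, ε] *ᵥ v) 2 =
        -Q0 * v 0 - Q1 * v 1 + ε * v 2 := by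
          simp [mulVec, dotProduct, Fin.sum_univ_three]; ring
      have hL : l 0 * (v 0 / c + l 1 * v 1) + l 1 * (t * v 0 / c - l 0 * v 1) = v 0 := by
        field_simp
        rw [hc]
        ring
      have hQ : q 0 * (v 0 / c + l 1 * v 1) ^ 2 + q 1 * (v 0 / c + l 1 * v 1) *
          (t * v 0 / c - l 0 * v 1) + q 2 * (t * v 0 / c - l 0 * v 1) ^ 2 =
          Q0 * v 0 ^ 2 + Q1 * v 0 * v 1 + Q2 * v 1 ^ 2 := by
        rw [hQ0, hQ1, hQ2]
        field_simp
        ring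
      rw [hv0, hv1, hv2, hL, hQ]
      simp
      field_simp
      linear_combination (c ^ 3 * v 0 * v 2 ^ 2) * hε
  have key2 : ∃ N : Matrix (Fin 3) (Fin 3) ℝ, N.det ≠ 0 ∧ ∃ k' : Fin 4 → ℝ, 0 < k' 0 ∧
      linSubst N (ternaryCubic k q l 0) = ternaryCubic k' ![0, 0, |Q2|] ![1, 0] 0 := by
    obtain h | h := abs_cases Q2
    · simpa [h.1] using key 1 (by norm_num)
    · simpa [h.1] using key (-1) (by norm_num)
  obtain ⟨N, hN, k', hk', h⟩ := key2
  refine ⟨M * N, by rw [det_mul]; exact mul_ne_zero hM hN, k', |Q2|, hk', abs_nonneg _, ?_⟩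
  rw [← linSubst_linSubst, hG, h]

/-! ### Contractible sets, lifts and arcs in the real projective plane -/

theorem RP2.continuous_mk {X : Type*} [TopologicalSpace X] {f : X → Fin 3 → ℝ} (hf : Continuous f)
    (h0 : ∀ x, f x ≠ 0) : Continuous (fun x => (Projectivization.mk ℝ (f x) (h0 x) : RP2)) := by
  have h1 : Continuous
      (fun v : {v : Fin 3 → ℝ // v ≠ 0} => (Projectivization.mk ℝ v.1 v.2 : RP2)) :=
    continuous_coinduced_rng
  exact h1.comp (hf.subtype_mk h0)

theorem dotProduct_self_pos {v : Fin 3 → ℝ} (hv : v ≠ 0) : 0 < v ⬝ᵥ v :=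
  lt_of_le_of_ne (Finset.sum_nonneg fun i _ => mul_self_nonneg (v i))
    (fun h => hv (dotProduct_self_eq_zero.1 h.symm))

/-- The matrix of the orthogonal projection of `ℝ³` onto the line `p`. -/
noncomputable def RP2.projMatrix : RP2 → Matrix (Fin 3) (Fin 3) ℝ :=
  Projectivization.lift (fun v => (v.1 ⬝ᵥ v.1)⁻¹ • vecMulVec v.1 v.1) (by
    rintro ⟨v, hv⟩ ⟨w, hw⟩ t (rfl : v = t • w)
    have ht : t ≠ 0 := by rintro rfl; simp at hv
    have := (dotProduct_self_pos hw).ne'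
    ext i j
    simp only [dotProduct_smul, smul_dotProduct, smul_eq_mul, vecMulVec, Matrix.smul_apply,
      of_apply,
      Pi.smul_apply]
    field_simp)

theorem RP2.projMatrix_mk {v : Fin 3 → ℝ} (hv : v ≠ 0) :
    RP2.projMatrix (Projectivization.mk ℝ v hv) = (v ⬝ᵥ v)⁻¹ • vecMulVec v v := rfl

theorem RP2.projMatrix_mk_mulVec {v : Fin 3 → ℝ} (hv : v ≠ 0) (u : Fin 3 → ℝ) :
    RP2.projMatrix (Projectivization.mk ℝ v hv) *ᵥ u = ((v ⬝ᵥ u) / (v ⬝ᵥ v)) • v := by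
  rw [RP2.projMatrix_mk, smul_mulVec, vecMulVec_mulVec, op_smul_eq_smul, smul_smul, div_eq_inv_mul]

theorem RP2.continuous_projMatrix : Continuous RP2.projMatrix := by
  refine continuous_coinduced_dom.2 ?_
  change Continuous fun v : {v : Fin 3 → ℝ // v ≠ 0} => (v.1 ⬝ᵥ v.1)⁻¹ • vecMulVec v.1 v.1
  refine Continuous.smul (Continuous.inv₀ (by fun_prop) fun v => (dotProduct_self_pos v.2).ne') ?_
  exact Continuous.matrix_vecMulVec (by fun_prop) (by fun_prop)

theorem RP2.trace_projMatrix_mul {v w : Fin 3 → ℝ} (hv : v ≠ 0) (hw : w ≠ 0) :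
    (RP2.projMatrix (Projectivization.mk ℝ v hv) *
        RP2.projMatrix (Projectivization.mk ℝ w hw)).trace
      = (v ⬝ᵥ w) ^ 2 / ((v ⬝ᵥ v) * (w ⬝ᵥ w)) := by
  have := (dotProduct_self_pos hv).ne'
  have := (dotProduct_self_pos hw).ne'
  rw [RP2.projMatrix_mk, RP2.projMatrix_mk, smul_mul_smul_comm, trace_smul, vecMulVec_mul_vecMulVec,
    trace_vecMulVec, dotProduct_smul, smul_eq_mul, smul_eq_mul]
  field_simp

/-- A set of points off a line is contained in an affine chart, so it is contractible. -/
theorem isContractibleInRP2_of_dotProduct_ne_zero {O : Set RP2} (w : Fin 3 → ℝ) (hw : w ≠ 0)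
    (hO : ∀ v (hv : v ≠ 0), Projectivization.mk ℝ v hv ∈ O → w ⬝ᵥ v ≠ 0) :
    IsContractibleInRP2 O := by
  have hpos (p : O) : 0 < w ⬝ᵥ (RP2.projMatrix p.1 *ᵥ w) := by
    obtain ⟨p, hp⟩ := p
    induction p using Projectivization.ind with
    | h v hv =>
      rw [RP2.projMatrix_mk_mulVec, dotProduct_smul, smul_eq_mul, dotProduct_comm v w,
        div_mul_eq_mul_div]
      exact div_pos (mul_self_pos.2 (hO v hv hp)) (dotProduct_self_pos hv)
  have hne (x : unitInterval × O) :
      (1 - (x.1 : ℝ)) • (RP2.projMatrix x.2.1 *ᵥ w) + (x.1 : ℝ) • w ≠ 0 := by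
    intro h0
    have h1 := congrArg (w ⬝ᵥ ·) h0
    simp only [dotProduct_add, dotProduct_smul, smul_eq_mul, dotProduct_zero] at h1
    have h2 := x.1.2.1
    have h3 := x.1.2.2
    rcases h2.eq_or_lt with h | h
    · rw [← h] at h1
      have := hpos x.2
      linarith
    · nlinarith [hpos x.2, dotProduct_self_pos hw]
  refine ⟨Projectivization.mk ℝ w hw, ⟨⟨⟨fun x => Projectivization.mk ℝ _ (hne x), ?_⟩, ?_, ?_⟩⟩⟩
  · apply RP2.continuous_mk
    have := RP2.continuous_projMatrix
    fun_prop
  · rintro ⟨p, hp⟩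
    change Projectivization.mk ℝ _ _ = p
    induction p using Projectivization.ind with
    | h v hv =>
      rw [Projectivization.mk_eq_mk_iff']
      exact ⟨(v ⬝ᵥ w) / (v ⬝ᵥ v), by simp [RP2.projMatrix_mk_mulVec]⟩
  · intro p
    change Projectivization.mk ℝ _ _ = Projectivization.mk ℝ _ _
    rw [Projectivization.mk_eq_mk_iff']
    exact ⟨1, by simp⟩

/-- `s` is a continuous choice of homogeneous coordinates along the map `f` to `ℝℙ²`. -/
def IsLift {K : Type*} [TopologicalSpace K] (f : K → RP2) (s : K → Fin 3 → ℝ) : Prop :=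
  Continuous s ∧ ∀ k, ∃ h : s k ≠ 0, Projectivization.mk ℝ (s k) h = f k

/-- If the lines `f k` and `g k` are never orthogonal, a lift of `f` projects orthogonally to a lift
of `g`. -/
theorem IsLift.of_trace_ne_zero {K : Type*} [TopologicalSpace K] {f g : K → RP2}
    {s : K → Fin 3 → ℝ} (hs : IsLift f s) (hg : Continuous g)
    (h : ∀ k, (RP2.projMatrix (f k) * RP2.projMatrix (g k)).trace ≠ 0) :
    IsLift g (fun k => RP2.projMatrix (g k) *ᵥ s k) := by
  refine ⟨(RP2.continuous_projMatrix.comp hg).matrix_mulVec hs.1, fun k => ?_⟩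
  obtain ⟨h0, hk⟩ := hs.2 k
  have := h k
  rw [← hk] at this
  change ∃ h : RP2.projMatrix (g k) *ᵥ s k ≠ 0, Projectivization.mk ℝ _ h = g k
  generalize g k = p at this ⊢
  induction p using Projectivization.ind with
  | h v hv =>
    rw [RP2.trace_projMatrix_mul] at this
    have hvs : v ⬝ᵥ s k ≠ 0 := by
      intro h
      rw [dotProduct_comm] at h
      simp [h] at this
    have hc : (v ⬝ᵥ s k) / (v ⬝ᵥ v) ≠ 0 := div_ne_zero hvs (dotProduct_self_pos hv).ne'
    refine ⟨by rw [RP2.projMatrix_mk_mulVec]; exact smul_ne_zero hc hv, ?_⟩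
    rw [Projectivization.mk_eq_mk_iff']
    exact ⟨_, (RP2.projMatrix_mk_mulVec hv _).symm⟩

/-- The homotopy starts from a constant map, which lifts. As the source is compact, lines at nearby
times are not orthogonal, so the set of times at which a lift exists is open and closed. -/
theorem exists_isLift_of_nullhomotopic {K : Type*} [TopologicalSpace K] [CompactSpace K]
    {f : C(K, RP2)} (hf : f.Nullhomotopic) : ∃ s, IsLift f s := by
  obtain ⟨y, ⟨H⟩⟩ := hf
  have hnear (t₀ : unitInterval) : ∀ᶠ t in 𝓝 t₀, ∀ k : K,
      (RP2.projMatrix (H (t₀, k)) * RP2.projMatrix (H (t, k))).trace ≠ 0 := by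
    have := isCompact_univ (X := K) |>.eventually_forall_of_forall_eventually (x₀ := t₀)
      (P := fun t k => (RP2.projMatrix (H (t₀, k)) * RP2.projMatrix (H (t, k))).trace ≠ 0) (by
        intro k _
        have hc : Continuous fun x : unitInterval × K =>
            (RP2.projMatrix (H (t₀, x.2)) * RP2.projMatrix (H (x.1, x.2))).trace := by
          have := RP2.continuous_projMatrix
          have hH : Continuous H := H.continuous
          refine Continuous.matrix_trace (Continuous.matrix_mul ?_ ?_)
          · exact this.comp (hH.comp (by fun_prop))
          · exact this.comp (hH.comp (by fun_prop))
        refine hc.continuousAt.eventually_ne ?_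
        simp only
        generalize H (t₀, k) = p
        induction p using Projectivization.ind with
        | h v hv =>
          have := (dotProduct_self_pos hv).ne'
          rw [RP2.trace_projMatrix_mul]
          positivity)
    filter_upwards [this] with t ht k using ht k trivial
  have hHc (t : unitInterval) : Continuous fun k => H (t, k) := H.continuous.comp (by fun_prop)
  have hclopen : IsClopen {t : unitInterval | ∃ s, IsLift (fun k => H (t, k)) s} := by
    constructor
    · rw [← isOpen_compl_iff, isOpen_iff_eventually]
      intro t₀ ht₀
      filter_upwards [hnear t₀] with t ht
      rintro ⟨s, hs⟩
      exact ht₀ ⟨_, hs.of_trace_ne_zero (hHc t₀) fun k => by rw [trace_mul_comm]; exact ht k⟩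
    · rw [isOpen_iff_eventually]
      rintro t₀ ⟨s, hs⟩
      filter_upwards [hnear t₀] with t ht
      exact ⟨_, hs.of_trace_ne_zero (hHc t) ht⟩
  have h1 : (1 : unitInterval) ∈ {t : unitInterval | ∃ s, IsLift (fun k => H (t, k)) s} := by
    refine ⟨fun _ => y.rep, continuous_const, fun k => ⟨y.rep_nonzero, ?_⟩⟩
    simp
  have h0 := hclopen.eq_univ ⟨1, h1⟩ ▸ Set.mem_univ (0 : unitInterval)
  simpa using h0

/-- The image in `ℝℙ²` of the path of vectors `U x`, `x ∈ [a, b]`. -/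
def projArc (a b : ℝ) (U : ℝ → Fin 3 → ℝ) : Set RP2 :=
  {p | ∃ x ∈ Set.Icc a b, ∃ h : U x ≠ 0, p = Projectivization.mk ℝ (U x) h}

section Arc
variable {a b : ℝ} {U V : ℝ → Fin 3 → ℝ}

theorem projArc_eq_range (h0 : ∀ x ∈ Set.Icc a b, U x ≠ 0) :
    projArc a b U = Set.range fun x : Set.Icc a b =>
      (Projectivization.mk ℝ (U x) (h0 x x.2) : RP2) := by
  ext p
  constructor
  · rintro ⟨x, hx, h, rfl⟩
    exact ⟨⟨x, hx⟩, rfl⟩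
  · rintro ⟨x, rfl⟩
    exact ⟨x, x.2, h0 x x.2, rfl⟩

theorem isCompact_projArc (hU : ContinuousOn U (Set.Icc a b)) (h0 : ∀ x ∈ Set.Icc a b, U x ≠ 0) :
    IsCompact (projArc a b U) := by
  rw [projArc_eq_range h0]
  exact isCompact_range (RP2.continuous_mk (continuousOn_iff_continuous_domRestrict.1 hU) _)

theorem isPreconnected_projArc (hU : ContinuousOn U (Set.Icc a b))
    (h0 : ∀ x ∈ Set.Icc a b, U x ≠ 0) : IsPreconnected (projArc a b U) := by
  rw [projArc_eq_range h0]
  have := Subtype.preconnectedSpace (isPreconnected_Icc (a := a) (b := b))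
  exact isPreconnected_range (RP2.continuous_mk (continuousOn_iff_continuous_domRestrict.1 hU) _)

/-- Two arcs with a common starting point form a connected set. -/
theorem isPreconnected_projArc_union (hU : ContinuousOn U (Set.Icc a b))
    (hV : ContinuousOn V (Set.Icc a b)) (hU0 : ∀ x ∈ Set.Icc a b, U x ≠ 0)
    (hV0 : ∀ x ∈ Set.Icc a b, V x ≠ 0) (hab : a ≤ b) {α : ℝ} (hα : U a = α • V a) :
    IsPreconnected (projArc a b U ∪ projArc a b V) := by
  have ha : a ∈ Set.Icc a b := ⟨le_rfl, hab⟩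
  refine IsPreconnected.union (Projectivization.mk ℝ (U a) (hU0 a ha)) ⟨a, ha, hU0 a ha, rfl⟩
    ⟨a, ha, hV0 a ha, ?_⟩ (isPreconnected_projArc hU hU0) (isPreconnected_projArc hV hV0)
  rw [Projectivization.mk_eq_mk_iff']
  exact ⟨α, hα.symm⟩

/-- Along an arc in `O` a lift is a nowhere vanishing multiple of the path of vectors, so the
factors at the two ends have the same sign. -/
theorem IsLift.exists_smul_projArc {O : Set RP2} {s : O → Fin 3 → ℝ}
    (hs : IsLift (fun p : O => p.1) s) (hU : ContinuousOn U (Set.Icc a b))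
    (hU0 : ∀ x ∈ Set.Icc a b, U x ≠ 0) (hab : a ≤ b) (hO : projArc a b U ⊆ O) :
    ∃ c d : ℝ, 0 < c * d ∧ (∀ p : O, (∃ h, p.1 = Projectivization.mk ℝ (U a) h) → s p = c • U a) ∧
      (∀ p : O, (∃ h, p.1 = Projectivization.mk ℝ (U b) h) → s p = d • U b) := by
  let P : Set.Icc a b → O := fun x =>
    ⟨Projectivization.mk ℝ (U x) (hU0 x x.2), hO ⟨x, x.2, hU0 x x.2, rfl⟩⟩
  have hUc := continuousOn_iff_continuous_domRestrict.1 hU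
  have hP : Continuous P := (RP2.continuous_mk hUc _).subtype_mk _
  let r : Set.Icc a b → ℝ := fun x => (s (P x) ⬝ᵥ U x) / (U x ⬝ᵥ U x)
  have hUc' : Continuous fun x : Set.Icc a b => U x := hUc
  have hr : Continuous r := by
    refine Continuous.div₀ ?_ ?_ fun x => (dotProduct_self_pos (hU0 x x.2)).ne'
    · exact (hs.1.comp hP).dotProduct hUc'
    · exact hUc'.dotProduct hUc'
  have hsr (x) : s (P x) = r x • U x := by
    obtain ⟨h, hx⟩ := hs.2 (P x)
    change _ = Projectivization.mk ℝ (U x) (hU0 x x.2) at hx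
    obtain ⟨c, hc⟩ := (Projectivization.mk_eq_mk_iff' _ _ _ _ _).1 hx
    have := (dotProduct_self_pos (hU0 x x.2)).ne'
    rw [show r x = c by simp [r, ← hc, this], hc]
  have hr0 (x) : r x ≠ 0 := fun h => (hs.2 (P x)).1 (by rw [hsr, h, zero_smul])
  have ha : a ∈ Set.Icc a b := ⟨le_rfl, hab⟩
  have hb : b ∈ Set.Icc a b := ⟨hab, le_rfl⟩
  refine ⟨r ⟨a, ha⟩, r ⟨b, hb⟩, ?_, ?_, ?_⟩
  · have := Subtype.preconnectedSpace (isPreconnected_Icc (a := a) (b := b))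
    by_contra! hle
    rcases mul_nonpos_iff.1 hle with ⟨h1, h2⟩ | ⟨h1, h2⟩
    · obtain ⟨x, hx⟩ := mem_range_of_exists_le_of_exists_ge hr ⟨_, h2⟩ ⟨_, h1⟩
      exact hr0 x hx
    · obtain ⟨x, hx⟩ := mem_range_of_exists_le_of_exists_ge hr ⟨_, h1⟩ ⟨_, h2⟩
      exact hr0 x hx
  · rintro p ⟨h, hp⟩
    rw [← hsr, show p = P ⟨a, ha⟩ from Subtype.ext hp]
  · rintro p ⟨h, hp⟩
    rw [← hsr, show p = P ⟨b, hb⟩ from Subtype.ext hp]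

/-- Two arcs from a common starting point to a common end point form a noncontractible set if, going
once around, homogeneous coordinates come back with the opposite sign: a null-homotopy would give
global homogeneous coordinates, which keep a constant sign relative to `U` and relative to `V`. -/
theorem not_isContractibleInRP2_projArc_union (hU : ContinuousOn U (Set.Icc a b))
    (hV : ContinuousOn V (Set.Icc a b)) (hU0 : ∀ x ∈ Set.Icc a b, U x ≠ 0)
    (hV0 : ∀ x ∈ Set.Icc a b, V x ≠ 0) (hab : a ≤ b) {α β : ℝ} (hα : U a = α • V a)
    (hβ : U b = β • V b) (hαβ : α * β < 0) :
    ¬ IsContractibleInRP2 (projArc a b U ∪ projArc a b V) := by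
  intro hO
  set O := projArc a b U ∪ projArc a b V with hOdef
  have : CompactSpace O :=
    isCompact_iff_compactSpace.1 ((isCompact_projArc hU hU0).union (isCompact_projArc hV hV0))
  obtain ⟨s, hs⟩ := exists_isLift_of_nullhomotopic hO
  have ha : a ∈ Set.Icc a b := ⟨le_rfl, hab⟩
  have hb : b ∈ Set.Icc a b := ⟨hab, le_rfl⟩
  obtain ⟨c, d, hcd, hc, hd⟩ :=
    IsLift.exists_smul_projArc (O := O) hs hU hU0 hab Set.subset_union_left
  obtain ⟨c', d', hcd', hc', hd'⟩ :=
    IsLift.exists_smul_projArc (O := O) hs hV hV0 hab Set.subset_union_right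
  let A : O := ⟨Projectivization.mk ℝ (U a) (hU0 a ha), .inl ⟨a, ha, hU0 a ha, rfl⟩⟩
  let B : O := ⟨Projectivization.mk ℝ (U b) (hU0 b hb), .inl ⟨b, hb, hU0 b hb, rfl⟩⟩
  have h1 := hc A ⟨hU0 a ha, rfl⟩
  have h2 := hd B ⟨hU0 b hb, rfl⟩
  rw [hc' A ⟨hV0 a ha, (Projectivization.mk_eq_mk_iff' _ _ _ _ _).2 ⟨α, hα.symm⟩⟩, hα,
    smul_smul] at h1
  rw [hd' B ⟨hV0 b hb, (Projectivization.mk_eq_mk_iff' _ _ _ _ _).2 ⟨β, hβ.symm⟩⟩, hβ,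
    smul_smul] at h2
  have e1 : c' = c * α := smul_left_injective ℝ (hV0 a ha) h1
  have e2 : d' = d * β := smul_left_injective ℝ (hV0 b hb) h2
  rw [e1, e2, show c * α * (d * β) = (c * d) * (α * β) by ring] at hcd'
  exact absurd hcd' (not_lt.2 (mul_nonpos_of_nonneg_of_nonpos hcd.le hαβ.le))

end Arc

/-! ### Quartics with simple real roots -/

/-- The leading term of a quartic dominates the others at some `R ≥ 1`. -/
theorem exists_pos_forall_cubic_lt {κ : ℝ} (hκ : 0 < κ) (c₃ c₂ c₁ c₀ : ℝ) :
    ∃ R : ℝ, 1 ≤ R ∧ |c₃| * R ^ 3 + |c₂| * R ^ 2 + |c₁| * R + |c₀| < κ * R ^ 4 := by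
  set S := |c₃| + |c₂| + |c₁| + |c₀| with hS
  have hS0 : 0 ≤ S := by positivity
  refine ⟨1 + S / κ, by have := div_nonneg hS0 hκ.le; linarith, ?_⟩
  have hR1 : 1 ≤ 1 + S / κ := by have := div_nonneg hS0 hκ.le; linarith
  have hR : κ * (1 + S / κ) = κ + S := by field_simp
  set R := 1 + S / κ
  have h3 : 1 ≤ R ^ 3 := one_le_pow₀ hR1
  have h2 : R ^ 2 ≤ R ^ 3 := pow_le_pow_right₀ hR1 (by norm_num)
  have h1 : R ≤ R ^ 3 := le_self_pow₀ hR1 (by norm_num)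
  have e2 := mul_le_mul_of_nonneg_left h2 (abs_nonneg c₂)
  have e1 := mul_le_mul_of_nonneg_left h1 (abs_nonneg c₁)
  have e0 := mul_le_mul_of_nonneg_left h3 (abs_nonneg c₀)
  have : κ * R ^ 4 = (κ + S) * R ^ 3 := by rw [← hR]; ring
  rw [this, hS]
  nlinarith

theorem exists_root_quartic {κ c₃ c₂ c₁ c₀ : ℝ} (hκ : 0 < κ) (h0 : 0 ≤ c₀) :
    ∃ r : ℝ, -κ * r ^ 4 + c₃ * r ^ 3 + c₂ * r ^ 2 + c₁ * r + c₀ = 0 := by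
  obtain ⟨R, hR, h⟩ := exists_pos_forall_cubic_lt hκ c₃ c₂ c₁ c₀
  have hc : Continuous fun r : ℝ => -κ * r ^ 4 + c₃ * r ^ 3 + c₂ * r ^ 2 + c₁ * r + c₀ := by
    fun_prop
  obtain ⟨r, hr⟩ := mem_range_of_exists_le_of_exists_ge hc (c := 0) ⟨R, by
    have e3 := mul_le_mul_of_nonneg_right (le_abs_self c₃) (show 0 ≤ R ^ 3 by positivity)
    have e2 := mul_le_mul_of_nonneg_right (le_abs_self c₂) (show 0 ≤ R ^ 2 by positivity)
    have e1 := mul_le_mul_of_nonneg_right (le_abs_self c₁) (show 0 ≤ R by positivity)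
    have e0 := le_abs_self c₀
    linarith⟩ ⟨0, by simpa using h0⟩
  exact ⟨r, hr⟩

theorem exists_root_cubic {κ c₂ c₁ c₀ : ℝ} (hκ : 0 < κ) :
    ∃ r : ℝ, -κ * r ^ 3 + c₂ * r ^ 2 + c₁ * r + c₀ = 0 := by
  obtain ⟨R, hR, h⟩ := exists_pos_forall_cubic_lt hκ c₂ c₁ c₀ 0
  have hR0 : 0 < R := by linarith
  have h' : |c₂| * R ^ 2 + |c₁| * R + |c₀| < κ * R ^ 3 := by
    rw [abs_zero] at h
    refine lt_of_mul_lt_mul_right ?_ hR0.le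
    linarith
  have hc : Continuous fun r : ℝ => -κ * r ^ 3 + c₂ * r ^ 2 + c₁ * r + c₀ := by fun_prop
  have e1 := mul_le_mul_of_nonneg_right (le_abs_self c₂) (show 0 ≤ R ^ 2 by positivity)
  have e2 := mul_le_mul_of_nonneg_right (le_abs_self c₁) hR0.le
  have e3 := mul_le_mul_of_nonneg_right (neg_abs_le c₂) (show 0 ≤ R ^ 2 by positivity)
  have e4 := neg_abs_le c₀
  have e5 := le_abs_self c₀
  obtain ⟨r, hr⟩ := mem_range_of_exists_le_of_exists_ge hc (c := 0)
    ⟨R, by linarith⟩ ⟨-R, by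
      rw [show -κ * (-R) ^ 3 + c₂ * (-R) ^ 2 + c₁ * (-R) + c₀ =
        κ * R ^ 3 + c₂ * R ^ 2 - c₁ * R + c₀ by ring]
      linarith⟩
  exact ⟨r, hr⟩

/-- A real quartic with negative leading coefficient, nonnegative at `0` and without multiple real
root has two or four real roots. -/
theorem quartic_factorization {κ c₃ c₂ c₁ c₀ : ℝ} (hκ : 0 < κ) (h0 : 0 ≤ c₀)
    (hs : ∀ r : ℝ, -κ * r ^ 4 + c₃ * r ^ 3 + c₂ * r ^ 2 + c₁ * r + c₀ = 0 →
      -4 * κ * r ^ 3 + 3 * c₃ * r ^ 2 + 2 * c₂ * r + c₁ ≠ 0) :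
    (∃ a b : ℝ, a < b ∧ ∃ w : ℝ → ℝ, (∀ x, 0 < w x) ∧
      ∀ x, -κ * x ^ 4 + c₃ * x ^ 3 + c₂ * x ^ 2 + c₁ * x + c₀ = -((x - a) * (x - b)) * w x) ∨
    ∃ a b c d : ℝ, a < b ∧ b < c ∧ c < d ∧
      ∀ x, -κ * x ^ 4 + c₃ * x ^ 3 + c₂ * x ^ 2 + c₁ * x + c₀ =
        -κ * (((x - a) * (x - b)) * ((x - c) * (x - d))) := by
  obtain ⟨r, hr⟩ := exists_root_quartic (c₃ := c₃) (c₂ := c₂) (c₁ := c₁) hκ h0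
  obtain ⟨g₂, hg₂⟩ : ∃ g₂, g₂ = c₃ - κ * r := ⟨_, rfl⟩
  obtain ⟨g₁, hg₁⟩ : ∃ g₁, g₁ = c₂ + g₂ * r := ⟨_, rfl⟩
  obtain ⟨g₀, hg₀⟩ : ∃ g₀, g₀ = c₁ + g₁ * r := ⟨_, rfl⟩
  obtain ⟨t, ht⟩ := exists_root_cubic (c₂ := g₂) (c₁ := g₁) (c₀ := g₀) hκ
  obtain ⟨h₁, hh₁⟩ : ∃ h₁, h₁ = g₂ - κ * t := ⟨_, rfl⟩
  obtain ⟨h₀, hh₀⟩ : ∃ h₀, h₀ = g₁ + h₁ * t := ⟨_, rfl⟩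
  have hc3 : c₃ = h₁ + κ * t + κ * r := by linarith
  have hc2 : c₂ = h₀ - h₁ * t - g₂ * r := by linarith
  have hg0 : g₀ = -h₀ * t := by rw [hh₀, hh₁]; linear_combination ht
  have hc1 : c₁ = -h₀ * t - g₁ * r := by linarith
  have hc0 : c₀ = h₀ * t * r := by
    have : c₀ = -g₀ * r := by rw [hg₀, hg₁, hg₂]; linear_combination hr
    rw [this, hg0]; ring
  have hg2 : g₂ = h₁ + κ * t := by linarith
  have hg1 : g₁ = h₀ - h₁ * t := by linarith
  have hf (x : ℝ) : -κ * x ^ 4 + c₃ * x ^ 3 + c₂ * x ^ 2 + c₁ * x + c₀ =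
      (x - r) * (x - t) * (-κ * x ^ 2 + h₁ * x + h₀) := by
    rw [hc3, hc2, hc1, hc0, hg2, hg1]; ring
  have hf' (x : ℝ) : -4 * κ * x ^ 3 + 3 * c₃ * x ^ 2 + 2 * c₂ * x + c₁ =
      (x - t) * (-κ * x ^ 2 + h₁ * x + h₀) + (x - r) * (-κ * x ^ 2 + h₁ * x + h₀) +
        (x - r) * (x - t) * (-2 * κ * x + h₁) := by
    rw [hc3, hc2, hc1, hg2, hg1]; ring
  simp only [hf, hf'] at hs ⊢
  clear hf hf' hc3 hc2 hc1 hc0 hg2 hg1 hg0 hh₁ hh₀ hg₂ hg₁ hg₀ hr ht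
  have hrt : r ≠ t := by
    rintro rfl
    exact hs r (by simp) (by simp)
  wlog hlt : r < t generalizing r t
  · simpa only [mul_comm (_ - t) (_ - r)] using this t r (by
      intro x hx
      have := hs x (by linarith)
      intro h
      apply this
      linarith) hrt.symm (lt_of_le_of_ne (not_lt.1 hlt) hrt.symm)
  rcases lt_trichotomy (h₁ ^ 2 + 4 * κ * h₀) 0 with h | h | h
  · refine .inl ⟨r, t, hlt, fun x => κ * x ^ 2 - h₁ * x - h₀, fun x => ?_, fun x => by ring⟩
    have : 4 * κ * (κ * x ^ 2 - h₁ * x - h₀) = (2 * κ * x - h₁) ^ 2 - (h₁ ^ 2 + 4 * κ * h₀) := by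
      ring
    have h2 : 0 < 4 * κ * (κ * x ^ 2 - h₁ * x - h₀) := by
      rw [this]; nlinarith [sq_nonneg (2 * κ * x - h₁)]
    exact pos_of_mul_pos_right h2 (by positivity)
  · exfalso
    have e : -κ * (h₁ / (2 * κ)) ^ 2 + h₁ * (h₁ / (2 * κ)) + h₀ = 0 := by
      field_simp
      linear_combination h
    have e' : -2 * κ * (h₁ / (2 * κ)) + h₁ = 0 := by field_simp; ring
    exact hs (h₁ / (2 * κ)) (by rw [e]; ring) (by rw [e, e']; ring)
  · have hsq := Real.sq_sqrt h.le
    have hpos := Real.sqrt_pos.2 h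
    set Δ := √(h₁ ^ 2 + 4 * κ * h₀)
    obtain ⟨c, hc⟩ : ∃ c, c = (h₁ - Δ) / (2 * κ) := ⟨_, rfl⟩
    obtain ⟨d, hd⟩ : ∃ d, d = (h₁ + Δ) / (2 * κ) := ⟨_, rfl⟩
    have hcd : c < d := by
      rw [hc, hd]
      gcongr
      linarith
    have hq (x : ℝ) : -κ * x ^ 2 + h₁ * x + h₀ = -κ * ((x - c) * (x - d)) := by
      rw [hc, hd]
      field_simp
      linear_combination -hsq
    have hq' (x : ℝ) : -2 * κ * x + h₁ = -κ * ((x - c) + (x - d)) := by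
      rw [hc, hd]
      field_simp
      ring
    simp only [hq, hq'] at hs ⊢
    clear hq hq' hc hd hsq hpos h
    have hrc : r ≠ c := by rintro rfl; exact hs r (by simp) (by simp)
    have hrd : r ≠ d := by rintro rfl; exact hs r (by simp) (by simp)
    have htc : t ≠ c := by rintro rfl; exact hs t (by simp) (by simp)
    have htd : t ≠ d := by rintro rfl; exact hs t (by simp) (by simp)
    right
    rcases lt_or_gt_of_ne hrc with h1 | h1
    · rcases lt_or_gt_of_ne htc with h2 | h2
      · exact ⟨r, t, c, d, hlt, h2, hcd, fun x => by ring⟩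
      · rcases lt_or_gt_of_ne htd with h3 | h3
        · exact ⟨r, c, t, d, h1, h2, h3, fun x => by ring⟩
        · exact ⟨r, c, d, t, h1, hcd, h3, fun x => by ring⟩
    · rcases lt_or_gt_of_ne htd with h3 | h3
      · exact ⟨c, r, t, d, h1, hlt, h3, fun x => by ring⟩
      · rcases lt_or_gt_of_ne hrd with h4 | h4
        · exact ⟨c, r, d, t, h1, h4, h3, fun x => by ring⟩
        · exact ⟨c, d, r, t, hcd, h4, hlt, fun x => by ring⟩

/-- The set where the quartic is nonnegative is one interval or the union of two disjoint ones;
`[a, b]` is the one that contains `0`. -/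
theorem quartic_nonneg_set {κ c₃ c₂ c₁ c₀ : ℝ} (hκ : 0 < κ) (h0 : 0 ≤ c₀)
    (hs : ∀ r : ℝ, -κ * r ^ 4 + c₃ * r ^ 3 + c₂ * r ^ 2 + c₁ * r + c₀ = 0 →
      -4 * κ * r ^ 3 + 3 * c₃ * r ^ 2 + 2 * c₂ * r + c₁ ≠ 0)
    {f : ℝ → ℝ} (hf : ∀ x, f x = -κ * x ^ 4 + c₃ * x ^ 3 + c₂ * x ^ 2 + c₁ * x + c₀) :
    ∃ a b : ℝ, a < b ∧ 0 ∈ Set.Icc a b ∧ f a = 0 ∧ f b = 0 ∧ (∀ x ∈ Set.Ioo a b, 0 < f x) ∧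
      ((∀ x, 0 ≤ f x → x ∈ Set.Icc a b) ∨
        ∃ c d : ℝ, c < d ∧ (b < c ∨ d < a) ∧ f c = 0 ∧ (∀ x ∈ Set.Icc c d, 0 ≤ f x) ∧
          ∀ x, 0 ≤ f x → x ∈ Set.Icc a b ∨ x ∈ Set.Icc c d) := by
  obtain ⟨a, b, hab, w, hw, h⟩ | ⟨a, b, c, d, hab, hbc, hcd, h⟩ := quartic_factorization hκ h0 hs
  · simp only [← hf] at h
    have key (x) (hx : 0 ≤ f x) : x ∈ Set.Icc a b := by
      rw [h] at hx
      have := nonneg_of_mul_nonneg_left hx (hw x)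
      constructor <;> by_contra! hc <;> nlinarith
    refine ⟨a, b, hab, key 0 (by rw [hf]; simpa using h0), by simp [h], by simp [h], ?_, .inl key⟩
    rintro x ⟨h1, h2⟩
    rw [h]
    exact mul_pos (by nlinarith) (hw x)
  · simp only [← hf] at h
    have h1 {x} (hx : x ∈ Set.Ioo a b) : 0 < f x := by
      obtain ⟨h1, h2⟩ := hx
      rw [h]
      have e1 : (x - a) * (x - b) < 0 := mul_neg_of_pos_of_neg (by linarith) (by linarith)
      have e2 : 0 < (x - c) * (x - d) := mul_pos_of_neg_of_neg (by linarith) (by linarith)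
      nlinarith [mul_pos hκ (mul_pos (neg_pos.2 e1) e2)]
    have h2 {x} (hx : x ∈ Set.Ioo c d) : 0 < f x := by
      obtain ⟨h1, h2⟩ := hx
      rw [h]
      have e1 : 0 < (x - a) * (x - b) := mul_pos (by linarith) (by linarith)
      have e2 : (x - c) * (x - d) < 0 := mul_neg_of_pos_of_neg (by linarith) (by linarith)
      nlinarith [mul_pos hκ (mul_pos e1 (neg_pos.2 e2))]
    have h3 (x) (hx : 0 ≤ f x) : x ∈ Set.Icc a b ∨ x ∈ Set.Icc c d := by
      by_contra! hn
      simp only [Set.mem_Icc, not_and_or, not_le] at hn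
      have : 0 < ((x - a) * (x - b)) * ((x - c) * (x - d)) := by
        apply mul_pos
        · rcases hn.1 with h | h
          · exact mul_pos_of_neg_of_neg (by linarith) (by linarith)
          · exact mul_pos (by linarith) (by linarith)
        · rcases hn.2 with h | h
          · exact mul_pos_of_neg_of_neg (by linarith) (by linarith)
          · exact mul_pos (by linarith) (by linarith)
      rw [h] at hx
      nlinarith [mul_pos hκ this]
    have ha : f a = 0 := by simp [h]
    have hb : f b = 0 := by simp [h]
    have hc : f c = 0 := by simp [h]
    have hd : f d = 0 := by simp [h]
    have h1' (x) (hx : x ∈ Set.Icc a b) : 0 ≤ f x := by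
      rcases eq_or_ne x a with rfl | hxa
      · exact ha.ge
      rcases eq_or_ne x b with rfl | hxb
      · exact hb.ge
      exact (h1 ⟨lt_of_le_of_ne hx.1 hxa.symm, lt_of_le_of_ne hx.2 hxb⟩).le
    have h2' (x) (hx : x ∈ Set.Icc c d) : 0 ≤ f x := by
      rcases eq_or_ne x c with rfl | hxa
      · exact hc.ge
      rcases eq_or_ne x d with rfl | hxb
      · exact hd.ge
      exact (h2 ⟨lt_of_le_of_ne hx.1 hxa.symm, lt_of_le_of_ne hx.2 hxb⟩).le
    rcases h3 0 (by rw [hf]; simpa using h0) with h | h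
    · exact ⟨a, b, hab, h, ha, hb, fun x hx => h1 hx, .inr ⟨c, d, hcd, .inl hbc, hc, h2', h3⟩⟩
    · exact ⟨c, d, hcd, h, hc, hd, fun x hx => h2 hx,
        .inr ⟨a, b, hab, .inr hbc, ha, h1', fun x hx => (h3 x hx).symm⟩⟩

/-- A multiple real root of the discriminant would give a singular point of the curve. -/
theorem IsSmoothRealCubic.discrim_simple {k : Fin 4 → ℝ} {q : ℝ}
    (h : IsSmoothRealCubic (ternaryCubic k ![0, 0, q] ![1, 0] 0)) (r : ℝ)
    (h0 : -k 0 * r ^ 4 + -k 1 * r ^ 3 + -k 2 * r ^ 2 + -k 3 * r + q ^ 2 = 0) :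
    -4 * k 0 * r ^ 3 + 3 * -k 1 * r ^ 2 + 2 * -k 2 * r + -k 3 ≠ 0 := by
  intro h1
  by_cases hr : r = 0
  · subst hr
    have hq : q = 0 := by simpa using h0
    have hk3 : k 3 = 0 := by simpa using h1
    obtain ⟨z, hz⟩ := IsAlgClosed.exists_pow_nat_eq (-(k 2 : ℂ)) (n := 2) (by norm_num)
    have := h.no_singular (x := 0) (y := 1) (z := z) (by simp [hz]) (by simp [hk3, hq])
      (by simp [hq])
    simp at this
  · have hr' : (r : ℂ) ≠ 0 := by exact_mod_cast hr
    have c0 : -(k 0 : ℂ) * r ^ 4 + -k 1 * r ^ 3 + -k 2 * r ^ 2 + -k 3 * r + q ^ 2 = 0 := by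
      exact_mod_cast h0
    have c1 : -4 * (k 0 : ℂ) * r ^ 3 + 3 * -k 1 * r ^ 2 + 2 * -k 2 * r + -k 3 = 0 := by
      exact_mod_cast h1
    have := h.no_singular (x := r) (y := 1) (z := -q / r)
      (by simp; field_simp; linear_combination c0 - r * c1)
      (by simp; field_simp; linear_combination -4 * c0 + r * c1)
      (by simp; field_simp; ring)
    simp at this

/-! ### The ovals of a cubic in normal form -/

/-- The value of the cubic form `x z² + 2 q y² z + K(x, y)`. -/
def normalCubic (k : Fin 4 → ℝ) (q : ℝ) (v : Fin 3 → ℝ) : ℝ :=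
  v 0 * v 2 ^ 2 + 2 * q * v 1 ^ 2 * v 2
    + (k 0 * v 0 ^ 3 + k 1 * v 0 ^ 2 * v 1 + k 2 * v 0 * v 1 ^ 2 + k 3 * v 1 ^ 3)

/-- The discriminant `q² - x K(x, 1)` (up to a factor `4`) of `x z² + 2 q z + K(x, 1)` as a
polynomial in `z`; it is nonnegative if the line through `(x : 1 : 0)` and `(0 : 0 : 1)` has further
real points on the curve. -/
def normalDiscr (k : Fin 4 → ℝ) (q x : ℝ) : ℝ :=
  q ^ 2 - x * (k 0 * x ^ 3 + k 1 * x ^ 2 + k 2 * x + k 3)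

theorem normalCubic_affine {k : Fin 4 → ℝ} {q x z : ℝ} : normalCubic k q ![x, 1, z] =
    x * z ^ 2 + 2 * q * z + (k 0 * x ^ 3 + k 1 * x ^ 2 + k 2 * x + k 3) := by
  simp [normalCubic]

/-- The points `(x : 1 : z)` of the curve with `x ∈ [a, b]`, in the coordinates given by `M`. -/
def normalSheet (M : Matrix (Fin 3) (Fin 3) ℝ) (k : Fin 4 → ℝ) (q a b : ℝ) : Set RP2 :=
  {p | ∃ x ∈ Set.Icc a b, ∃ z, normalCubic k q ![x, 1, z] = 0 ∧
    ∃ h : M *ᵥ ![x, 1, z] ≠ 0, p = Projectivization.mk ℝ _ h}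

/-- The point `(0 : 0 : 1)`, as a singleton, in the coordinates given by `M`. -/
def normalCenter (M : Matrix (Fin 3) (Fin 3) ℝ) : Set RP2 :=
  {p | ∃ h : M *ᵥ ![0, 0, 1] ≠ 0, p = Projectivization.mk ℝ _ h}

section
variable {M : Matrix (Fin 3) (Fin 3) ℝ} {k : Fin 4 → ℝ} {q : ℝ}

theorem mulVec_ne_zero_of_det_ne_zero (hM : M.det ≠ 0) {v : Fin 3 → ℝ} (hv : v ≠ 0) :
    M *ᵥ v ≠ 0 := fun h =>
  hv (mulVec_injective_of_isUnit ((isUnit_iff_isUnit_det M).2 (isUnit_iff_ne_zero.2 hM))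
    (by simpa using h))

theorem vec_ne_zero_of_apply {v : Fin 3 → ℝ} {i : Fin 3} (h : v i ≠ 0) : v ≠ 0 :=
  fun h0 => h (congrFun h0 i)

theorem mk_mulVec_eq_of_smul {u v : Fin 3 → ℝ} (hu : M *ᵥ u ≠ 0) (hv : M *ᵥ v ≠ 0) (c : ℝ)
    (h : u = c • v) :
    (Projectivization.mk ℝ _ hu : RP2) = Projectivization.mk ℝ _ hv :=
  (Projectivization.mk_eq_mk_iff' _ _ _ _ _).2 ⟨c, by rw [h, mulVec_smul]⟩

theorem sq_eq_normalDiscr {x z : ℝ} (h : normalCubic k q ![x, 1, z] = 0) :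
    (x * z + q) ^ 2 = normalDiscr k q x := by
  rw [normalCubic_affine] at h
  rw [normalDiscr]
  linear_combination x * h

theorem normalCubic_eq_zero_of_sq {x z : ℝ} (hx : x ≠ 0)
    (h : (x * z + q) ^ 2 = normalDiscr k q x) : normalCubic k q ![x, 1, z] = 0 := by
  rw [normalCubic_affine]
  rw [normalDiscr] at h
  refine (mul_eq_zero.1 ?_).resolve_left hx
  linear_combination h

theorem add_eq_sqrt_or {x z : ℝ} (h : normalCubic k q ![x, 1, z] = 0) :
    x * z + q = √(normalDiscr k q x) ∨ x * z + q = -√(normalDiscr k q x) := by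
  rw [← sq_eq_normalDiscr h, Real.sqrt_sq_eq_abs]
  rcases abs_choice (x * z + q) with h | h <;> rw [h] <;> simp

theorem continuous_normalDiscr : Continuous (normalDiscr k q) := by
  unfold normalDiscr; fun_prop

theorem ContinuousOn.mulVec_vec {s : Set ℝ} {f g h : ℝ → ℝ} (M : Matrix (Fin 3) (Fin 3) ℝ)
    (hf : ContinuousOn f s)
    (hg : ContinuousOn g s) (hh : ContinuousOn h s) :
    ContinuousOn (fun x => M *ᵥ ![f x, g x, h x]) s := by
  have h1 : ContinuousOn (fun x => ![f x, g x, h x]) s := by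
    refine continuousOn_pi.2 fun i => ?_
    fin_cases i <;> assumption
  exact (Continuous.matrix_mulVec continuous_const continuous_id).comp_continuousOn h1

/-- Over an interval that avoids `0` the two solutions `z` of the quadratic equation depend
continuously on `x` and agree at the ends. -/
theorem isPreconnected_normalSheet (hM : M.det ≠ 0) {c d : ℝ} (hcd : c < d)
    (h0 : 0 ∉ Set.Icc c d) (hc : normalDiscr k q c = 0)
    (hD : ∀ x ∈ Set.Icc c d, 0 ≤ normalDiscr k q x) :
    IsPreconnected (normalSheet M k q c d) ∧ (normalSheet M k q c d).Nonempty := by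
  have hx0 {x} (hx : x ∈ Set.Icc c d) : x ≠ 0 := fun h => h0 (h ▸ hx)
  let U (ε x : ℝ) : Fin 3 → ℝ := M *ᵥ ![x, 1, (ε * √(normalDiscr k q x) - q) / x]
  have hU (ε : ℝ) : ContinuousOn (U ε) (Set.Icc c d) := by
    refine ContinuousOn.mulVec_vec M continuousOn_id continuousOn_const ?_
    refine ContinuousOn.div ?_ continuousOn_id fun x hx => hx0 hx
    have := (continuous_normalDiscr (k := k) (q := q)).sqrt
    exact ((continuous_const.mul this).sub continuous_const).continuousOn
  have hne (ε x : ℝ) : U ε x ≠ 0 :=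
    mulVec_ne_zero_of_det_ne_zero hM (vec_ne_zero_of_apply (i := 1) (by simp))
  have hmem (ε : ℝ) (hε : ε ^ 2 = 1) : projArc c d (U ε) ⊆ normalSheet M k q c d := by
    rintro p ⟨x, hx, h, rfl⟩
    refine ⟨x, hx, _, normalCubic_eq_zero_of_sq (hx0 hx) ?_, h, rfl⟩
    rw [mul_div_cancel₀ _ (hx0 hx), sub_add_cancel, mul_pow, hε, Real.sq_sqrt (hD x hx), one_mul]
  have heq : normalSheet M k q c d = projArc c d (U 1) ∪ projArc c d (U (-1)) := by
    refine Set.Subset.antisymm ?_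
      (Set.union_subset (hmem 1 (by norm_num)) (hmem (-1) (by norm_num)))
    rintro p ⟨x, hx, z, hz, h, rfl⟩
    rcases add_eq_sqrt_or hz with h1 | h1
    · refine .inl ⟨x, hx, hne 1 x, mk_mulVec_eq_of_smul _ _ 1 ?_⟩
      rw [one_smul, ← h1]
      congr 3
      field_simp [hx0 hx]
      ring
    · refine .inr ⟨x, hx, hne (-1) x, mk_mulVec_eq_of_smul _ _ 1 ?_⟩
      rw [one_smul, neg_one_mul, ← h1]
      congr 3
      field_simp [hx0 hx]
      ring
  constructor
  · rw [heq]
    refine isPreconnected_projArc_union (hU 1) (hU (-1)) (fun x _ => hne _ x) (fun x _ => hne _ x)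
      hcd.le (α := 1) ?_
    simp [U, hc]
  · exact ⟨_, hmem 1 (by norm_num) ⟨c, ⟨le_rfl, hcd.le⟩, hne 1 c, rfl⟩⟩

theorem isContractibleInRP2_normalSheet (hM : M.det ≠ 0) {c d : ℝ} :
    IsContractibleInRP2 (normalSheet M k q c d) := by
  have hu : IsUnit M.det := isUnit_iff_ne_zero.2 hM
  have hrow (v : Fin 3 → ℝ) : M⁻¹ 1 ⬝ᵥ (M *ᵥ v) = v 1 := by
    have : (M⁻¹ *ᵥ (M *ᵥ v)) 1 = v 1 := by rw [mulVec_mulVec, nonsing_inv_mul _ hu, one_mulVec]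
    exact this
  refine isContractibleInRP2_of_dotProduct_ne_zero (M⁻¹ 1) ?_ ?_
  · intro h
    have := hrow ![0, 1, 0]
    rw [h] at this
    simp at this
  · rintro v hv ⟨x, -, z, -, h, heq⟩
    obtain ⟨c, rfl⟩ := (Projectivization.mk_eq_mk_iff' _ _ _ _ _).1 heq
    rw [dotProduct_smul, hrow]
    have hc : c ≠ 0 := by rintro rfl; simp at hv
    simpa using hc

/-- The oval through the centre when `q > 0`. The solution `z = K / (-q - √D)` stays finite at `x =
0`; the other one, `z = (-q - √D) / x`, passes through the centre there, and in the coordinates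
`(x², x, -q - √D)` the sign of `y` changes on the way. -/
theorem normalSheet_union_center_of_pos (hM : M.det ≠ 0) (hq : 0 < q) {a b : ℝ} (hab : a < b)
    (h0 : 0 ∈ Set.Icc a b) (ha : normalDiscr k q a = 0) (hb : normalDiscr k q b = 0)
    (hD : ∀ x ∈ Set.Icc a b, 0 ≤ normalDiscr k q x) :
    IsPreconnected (normalSheet M k q a b ∪ normalCenter M) ∧
      ¬ IsContractibleInRP2 (normalSheet M k q a b ∪ normalCenter M) := by
  have hD0 : normalDiscr k q 0 = q ^ 2 := by simp [normalDiscr]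
  have ha0 : a < 0 := lt_of_le_of_ne h0.1 (by
    rintro rfl
    rw [hD0] at ha
    exact (pow_pos hq 2).ne' ha)
  have hb0 : 0 < b := lt_of_le_of_ne h0.2 (by
    rintro rfl
    rw [hD0] at hb
    exact (pow_pos hq 2).ne' hb)
  let K (x : ℝ) := k 0 * x ^ 3 + k 1 * x ^ 2 + k 2 * x + k 3
  let w (x : ℝ) := √(normalDiscr k q x)
  have hw (x) (hx : x ∈ Set.Icc a b) : w x ^ 2 = q ^ 2 - x * K x := Real.sq_sqrt (hD x hx)
  have hwc : Continuous w := (continuous_normalDiscr (k := k) (q := q)).sqrt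
  have hwn (x) : 0 ≤ w x := Real.sqrt_nonneg _
  have hne0 (x) : -q - w x ≠ 0 := by have := hwn x; linarith
  let U (x : ℝ) : Fin 3 → ℝ := M *ᵥ ![x, 1, K x / (-q - w x)]
  let V (x : ℝ) : Fin 3 → ℝ := M *ᵥ ![x ^ 2, x, -q - w x]
  have hU : ContinuousOn U (Set.Icc a b) := by
    refine ContinuousOn.mulVec_vec M continuousOn_id continuousOn_const ?_
    refine ContinuousOn.div (by fun_prop) (by fun_prop) fun x hx => hne0 x
  have hV : ContinuousOn V (Set.Icc a b) :=
    ContinuousOn.mulVec_vec M (by fun_prop) continuousOn_id (by fun_prop)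
  have hU0 (x : ℝ) : U x ≠ 0 :=
    mulVec_ne_zero_of_det_ne_zero hM (vec_ne_zero_of_apply (i := 1) (by simp))
  have hV0 (x : ℝ) : V x ≠ 0 :=
    mulVec_ne_zero_of_det_ne_zero hM (vec_ne_zero_of_apply (i := 2) (by simpa using hne0 x))
  have heq : normalSheet M k q a b ∪ normalCenter M = projArc a b U ∪ projArc a b V := by
    refine Set.Subset.antisymm (Set.union_subset ?_ ?_) (Set.union_subset ?_ ?_)
    · rintro p ⟨x, hx, z, hz, h, rfl⟩
      have hN := normalCubic_affine.symm.trans hz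
      rcases add_eq_sqrt_or hz with h1 | h1
      · refine .inl ⟨x, hx, hU0 x, mk_mulVec_eq_of_smul _ _ 1 ?_⟩
        rw [one_smul]
        congr 3
        rw [eq_div_iff (hne0 x)]
        change x * z + q = w x at h1
        by_cases hx0 : x = 0
        · rw [← h1, hx0]
          simp only [K]
          rw [hx0] at hN
          linear_combination -hN
        · apply mul_left_cancel₀ hx0
          simp only [K]
          rw [← h1]
          linear_combination -x * hN
      · change x * z + q = -w x at h1
        have hx0 : x ≠ 0 := by
          rintro rfl
          have := hwn 0
          linarith
        refine .inr ⟨x, hx, hV0 x, mk_mulVec_eq_of_smul _ _ x⁻¹ ?_⟩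
        ext i
        fin_cases i <;> simp <;> field_simp
        linarith
    · rintro p ⟨h, rfl⟩
      refine .inr ⟨0, h0, hV0 0, mk_mulVec_eq_of_smul _ _ (-q - w 0)⁻¹ ?_⟩
      ext i
      fin_cases i <;> simp [hne0]
    · rintro p ⟨x, hx, h, rfl⟩
      refine .inl ⟨x, hx, _, ?_, h, rfl⟩
      rw [normalCubic_affine]
      have := hne0 x
      change x * (K x / (-q - w x)) ^ 2 + 2 * q * (K x / (-q - w x)) + K x = 0
      field_simp
      linear_combination K x * hw x hx
    · rintro p ⟨x, hx, h, rfl⟩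
      by_cases hx0 : x = 0
      · refine .inr ⟨mulVec_ne_zero_of_det_ne_zero hM (vec_ne_zero_of_apply (i := 2) (by simp)),
          mk_mulVec_eq_of_smul _ _ (-q - w x) ?_⟩
        ext i
        fin_cases i <;> simp [hx0]
      · refine .inl ⟨x, hx, (-q - w x) / x, normalCubic_eq_zero_of_sq hx0 ?_,
          mulVec_ne_zero_of_det_ne_zero hM (vec_ne_zero_of_apply (i := 1) (by simp)),
          mk_mulVec_eq_of_smul _ _ x ?_⟩
        · rw [mul_div_cancel₀ _ hx0, ← Real.sq_sqrt (hD x hx)]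
          change _ = w x ^ 2
          ring
        · ext i
          fin_cases i <;> simp <;> field_simp
  have hend (x) (hx : normalDiscr k q x = 0) (hx0 : x ≠ 0) : U x = x⁻¹ • V x := by
    have hwx : w x = 0 := by simp only [w]; rw [hx, Real.sqrt_zero]
    have hxx : q ^ 2 - x * K x = 0 := hx
    simp only [U, V]
    rw [← mulVec_smul]
    congr 1
    ext i
    fin_cases i <;> simp [hwx] <;> field_simp
    linear_combination hxx
  have hea := hend a ha ha0.ne
  have heb := hend b hb hb0.ne'
  rw [heq]
  exact ⟨isPreconnected_projArc_union hU hV (fun x _ => hU0 x) (fun x _ => hV0 x) hab.le hea,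
    not_isContractibleInRP2_projArc_union hU hV (fun x _ => hU0 x) (fun x _ => hV0 x) hab.le
      hea heb (mul_neg_of_neg_of_pos (inv_lt_zero.2 ha0) (inv_pos.2 hb0))⟩

/-- The oval through the centre when `q = 0`, so that the centre is a flex and `0` an end of the
interval. Both arcs, in the coordinates `(x √|x|, √|x|, ±√|K|)`, start at the centre, with opposite
signs. -/
theorem normalSheet_union_center_of_zero (hM : M.det ≠ 0) (hk3 : k 3 ≠ 0) {a b : ℝ} (hab : a < b)
    (h0 : 0 ∈ Set.Icc a b) (ha : normalDiscr k 0 a = 0) (hb : normalDiscr k 0 b = 0)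
    (hD : ∀ x ∈ Set.Ioo a b, 0 < normalDiscr k 0 x) :
    IsPreconnected (normalSheet M k 0 a b ∪ normalCenter M) ∧
      ¬ IsContractibleInRP2 (normalSheet M k 0 a b ∪ normalCenter M) := by
  let K (x : ℝ) := k 0 * x ^ 3 + k 1 * x ^ 2 + k 2 * x + k 3
  have hDK (x) : normalDiscr k 0 x = -(x * K x) := by simp only [normalDiscr, K]; ring
  have hK0 : K 0 ≠ 0 := by simpa [K] using hk3
  have hD' (x) (hx : x ∈ Set.Icc a b) : 0 ≤ normalDiscr k 0 x := by
    rcases eq_or_ne x a with rfl | hxa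
    · exact ha.ge
    rcases eq_or_ne x b with rfl | hxb
    · exact hb.ge
    exact (hD x ⟨lt_of_le_of_ne hx.1 hxa.symm, lt_of_le_of_ne hx.2 hxb⟩).le
  have habs (x) (hx : x ∈ Set.Icc a b) : x * |K x| = -(|x| * K x) := by
    have h1 := hD' x hx
    rw [hDK] at h1
    rcases lt_trichotomy x 0 with h | h | h
    · have : 0 ≤ K x := by by_contra! hK; nlinarith
      rw [abs_of_neg h, abs_of_nonneg this]
      ring
    · simp [h]
    · have : K x ≤ 0 := by by_contra! hK; nlinarith
      rw [abs_of_pos h, abs_of_nonpos this]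
      ring
  let U (ε x : ℝ) : Fin 3 → ℝ := M *ᵥ ![x * √|x|, √|x|, ε * √|K x|]
  have hU (ε : ℝ) : ContinuousOn (U ε) (Set.Icc a b) :=
    ContinuousOn.mulVec_vec M (by fun_prop) (by fun_prop) (by fun_prop)
  have hU0 (ε x : ℝ) (hε : ε ^ 2 = 1) : U ε x ≠ 0 := by
    by_cases hx : x = 0
    · refine mulVec_ne_zero_of_det_ne_zero hM (vec_ne_zero_of_apply (i := 2) ?_)
      have hε0 : ε ≠ 0 := by rintro rfl; simp at hε
      have : √|K x| ≠ 0 := by rw [hx]; exact (Real.sqrt_pos.2 (abs_pos.2 hK0)).ne'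
      exact mul_ne_zero hε0 this
    · refine mulVec_ne_zero_of_det_ne_zero hM (vec_ne_zero_of_apply (i := 1) ?_)
      exact (Real.sqrt_pos.2 (abs_pos.2 hx)).ne'
  have e1 : (1 : ℝ) ^ 2 = 1 := by norm_num
  have e2 : (-1 : ℝ) ^ 2 = 1 := by norm_num
  have hmem (ε : ℝ) (hε : ε ^ 2 = 1) :
      projArc a b (U ε) ⊆ normalSheet M k 0 a b ∪ normalCenter M := by
    rintro p ⟨x, hx, h, rfl⟩
    by_cases hx0 : x = 0
    · refine .inr ⟨mulVec_ne_zero_of_det_ne_zero hM (vec_ne_zero_of_apply (i := 2) (by simp)),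
          mk_mulVec_eq_of_smul _ _ (ε * √|K x|) ?_⟩
      ext i
      fin_cases i <;> simp [hx0]
    · have hs : √|x| ≠ 0 := (Real.sqrt_pos.2 (abs_pos.2 hx0)).ne'
      refine .inl ⟨x, hx, ε * √|K x| / √|x|, ?_,
          mulVec_ne_zero_of_det_ne_zero hM (vec_ne_zero_of_apply (i := 1) (by simp)),
          mk_mulVec_eq_of_smul _ _ (√|x|) ?_⟩
      · rw [normalCubic_affine]
        change _ + K x = 0
        have hx1 : |x| ≠ 0 := abs_ne_zero.2 hx0
        rw [div_pow, mul_pow, hε, Real.sq_sqrt (abs_nonneg _), Real.sq_sqrt (abs_nonneg _)]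
        have := habs x hx
        rw [mul_zero, zero_mul, add_zero, one_mul, mul_div_assoc', div_add' _ _ _ hx1,
          div_eq_zero_iff]
        left
        linarith
      · ext i
        fin_cases i <;> simp <;> field_simp
  have heq : normalSheet M k 0 a b ∪ normalCenter M = projArc a b (U 1) ∪ projArc a b (U (-1)) := by
    refine Set.Subset.antisymm (Set.union_subset ?_ ?_) (Set.union_subset (hmem 1 e1) (hmem _ e2))
    · rintro p ⟨x, hx, z, hz, h, rfl⟩
      have hN : x * z ^ 2 + K x = 0 := by
        have := normalCubic_affine.symm.trans hz
        simp only [K]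
        linear_combination this
      have hx0 : x ≠ 0 := by
        rintro rfl
        apply hK0
        linear_combination hN
      have hs : √|x| ≠ 0 := (Real.sqrt_pos.2 (abs_pos.2 hx0)).ne'
      have habs2 : √|K x| = √|x| * |z| := by
        rw [← Real.sqrt_sq_eq_abs z, ← Real.sqrt_mul (abs_nonneg x), eq_neg_of_add_eq_zero_right hN,
          abs_neg, abs_mul, abs_of_nonneg (sq_nonneg z)]
      rcases abs_choice z with hz' | hz'
      · refine .inl ⟨x, hx, hU0 1 x e1, mk_mulVec_eq_of_smul _ _ (√|x|)⁻¹ ?_⟩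
        rw [habs2, hz']
        ext i
        fin_cases i <;> simp <;> field_simp
      · refine .inr ⟨x, hx, hU0 (-1) x e2, mk_mulVec_eq_of_smul _ _ (√|x|)⁻¹ ?_⟩
        rw [habs2, hz']
        ext i
        fin_cases i <;> simp <;> field_simp
    · rintro p ⟨h, rfl⟩
      have hs : √|K 0| ≠ 0 := (Real.sqrt_pos.2 (abs_pos.2 hK0)).ne'
      refine .inl ⟨0, h0, hU0 1 0 e1, mk_mulVec_eq_of_smul _ _ (√|K 0|)⁻¹ ?_⟩
      ext i
      fin_cases i <;> simp [hs]
  -- the two arcs leave the centre with opposite orientation and meet again at the other end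
  have hend0 : U 1 0 = (-1 : ℝ) • U (-1) 0 := by
    simp only [U]
    rw [← mulVec_smul]
    congr 1
    ext i
    fin_cases i <;> simp
  have hend (x) (hx : normalDiscr k 0 x = 0) (hx0 : x ≠ 0) : U 1 x = (1 : ℝ) • U (-1) x := by
    rw [hDK, neg_eq_zero] at hx
    have : K x = 0 := (mul_eq_zero.1 hx).resolve_left hx0
    simp [U, this]
  have hcon (α : ℝ) (hα : U 1 a = α • U (-1) a) :
      IsPreconnected (normalSheet M k 0 a b ∪ normalCenter M) := by
    rw [heq]
    exact isPreconnected_projArc_union (hU 1) (hU (-1)) (fun x _ => hU0 _ x e1)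
      (fun x _ => hU0 _ x e2) hab.le hα
  have hnot (α β : ℝ) (hα : U 1 a = α • U (-1) a) (hβ : U 1 b = β • U (-1) b)
      (hαβ : α * β < 0) : ¬ IsContractibleInRP2 (normalSheet M k 0 a b ∪ normalCenter M) := by
    rw [heq]
    exact not_isContractibleInRP2_projArc_union (hU 1) (hU (-1)) (fun x _ => hU0 _ x e1)
      (fun x _ => hU0 _ x e2) hab.le hα hβ hαβ
  rcases h0.1.eq_or_lt with rfl | ha0
  · have hβ := hend b hb hab.ne'
    exact ⟨hcon _ hend0, hnot _ _ hend0 hβ (by norm_num)⟩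
  · have hα := hend a ha ha0.ne
    refine ⟨hcon _ hα, ?_⟩
    rcases h0.2.eq_or_lt with rfl | hb0
    · exact hnot _ _ hα hend0 (by norm_num)
    · have := hD 0 ⟨ha0, hb0⟩
      simp [normalDiscr] at this

end

/-! ### The parity of the intersection of a line with an oval -/

section
variable {k : Fin 4 → ℝ} {q : ℝ}

/-- For `w = (x, 1, z)` this is `m (m - x)`, which is positive at `x = 0` and changes sign at `x =
m`. It is homogeneous of degree two, so its sign is defined on `ℝℙ²`. -/
def gapSign (m : ℝ) (w : Fin 3 → ℝ) : ℝ := m * w 1 * (m * w 1 - w 0)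

theorem gapSign_smul (m c : ℝ) (w : Fin 3 → ℝ) : gapSign m (c • w) = c ^ 2 * gapSign m w := by
  simp [gapSign]; ring

/-- The line `y = 0` meets the curve only in `(0 : 0 : 1)`. -/
theorem apply_zero_of_apply_one (hk : 0 < k 0) {w : Fin 3 → ℝ} (hw : normalCubic k q w = 0)
    (h1 : w 1 = 0) : w 0 = 0 := by
  simp only [normalCubic, h1] at hw
  have : w 0 * (w 2 ^ 2 + k 0 * w 0 ^ 2) = 0 := by linear_combination hw
  rcases mul_eq_zero.1 this with h | h
  · exact h
  · by_contra h0
    have : 0 < k 0 * w 0 ^ 2 := by positivity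
    nlinarith [sq_nonneg (w 2)]

/-- A line through the centre `(0 : 0 : 1)`: its two other intersection points with the curve have
the same direction from the centre, and neither can be the centre itself unless the line is the
tangent `x = 0` there. -/
theorem gapSign_neg_of_center (hk : 0 < k 0) {u v : Fin 3 → ℝ}
    (huv : ∀ s t : ℝ, s • u + t • v = 0 → s = 0 ∧ t = 0) {a a' a'' b b' b'' c : ℝ}
    (hN : ∀ s t : ℝ, normalCubic k q (s • u + t • v) =
      c * ((s * b - t * a) * (s * b' - t * a') * (s * b'' - t * a'')))
    {m : ℝ} (h' : a' • u + b' • v ≠ 0) (h0 : (a' • u + b' • v) 1 = 0)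
    (hS : gapSign m (a • u + b • v) < 0) :
    gapSign m (a'' • u + b'' • v) < 0 := by
  have hz' : (a' • u + b' • v) 0 = 0 := apply_zero_of_apply_one hk (q := q) (by rw [hN]; ring) h0
  simp only [Pi.add_apply, Pi.smul_apply, smul_eq_mul] at h0 hz'
  have hab' : ¬ (a' = 0 ∧ b' = 0) := by rintro ⟨rfl, rfl⟩; simp at h'
  have hδ : u 0 * v 1 - u 1 * v 0 = 0 := by
    by_contra hδ
    refine hab' ⟨?_, ?_⟩ <;> apply mul_right_cancel₀ hδ
    · linear_combination v 1 * hz' - v 0 * h0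
    · linear_combination u 0 * h0 - u 1 * hz'
  by_cases h1 : (a'' • u + b'' • v) 1 = 0
  · exfalso
    have hz'' : (a'' • u + b'' • v) 0 = 0 :=
      apply_zero_of_apply_one hk (q := q) (by rw [hN]; ring) h1
    simp only [Pi.add_apply, Pi.smul_apply, smul_eq_mul] at h1 hz''
    have hρ' : a' * u 2 + b' * v 2 ≠ 0 := by
      intro h
      apply h'
      ext i
      fin_cases i <;> simp [*]
    obtain ⟨ρ, hρ⟩ : ∃ ρ, ρ = (a'' * u 2 + b'' * v 2) / (a' * u 2 + b' * v 2) := ⟨_, rfl⟩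
    have hρ2 : a'' * u 2 + b'' * v 2 = ρ * (a' * u 2 + b' * v 2) := by
      rw [hρ, div_mul_cancel₀ _ hρ']
    obtain ⟨ea, eb⟩ := huv (a'' - ρ * a') (b'' - ρ * b') (by
      ext i
      fin_cases i <;> simp
      · linear_combination hz'' - ρ * hz'
      · linear_combination h1 - ρ * h0
      · linear_combination hρ2)
    have ea' : a'' = ρ * a' := by linarith
    have eb' : b'' = ρ * b' := by linarith
    -- along `w' + τ w` the restriction vanishes to order two at `τ = 0`
    have hτ (τ : ℝ) := hN (a' + τ * a) (b' + τ * b)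
    have hτ0 (τ : ℝ) : ((a' + τ * a) • u + (b' + τ * b) • v) 0 = τ * (a * u 0 + b * v 0) := by
      simp; linear_combination hz'
    have hτ1 (τ : ℝ) : ((a' + τ * a) • u + (b' + τ * b) • v) 1 = τ * (a * u 1 + b * v 1) := by
      simp; linear_combination h0
    have hτ2 (τ : ℝ) : ((a' + τ * a) • u + (b' + τ * b) • v) 2 =
        (a' * u 2 + b' * v 2) + τ * (a * u 2 + b * v 2) := by
      simp; ring
    simp only [normalCubic, hτ0, hτ1, hτ2, ea', eb'] at hτ
    have hx : a * u 0 + b * v 0 ≠ 0 := by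
      intro h
      simp only [gapSign, Pi.add_apply, Pi.smul_apply, smul_eq_mul, h] at hS
      nlinarith [sq_nonneg (m * (a * u 1 + b * v 1))]
    have t1 := hτ 1
    have t2 := hτ (-1)
    have t3 := hτ 2
    have : (a * u 0 + b * v 0) * (a' * u 2 + b' * v 2) ^ 2 = 0 := by
      linear_combination t1 - 1 / 3 * t2 - 1 / 6 * t3
    rcases mul_eq_zero.1 this with h | h
    · exact hx h
    · exact hρ' (pow_eq_zero_iff (by norm_num) |>.1 h)
  · have e : gapSign m (a'' • u + b'' • v) * (a • u + b • v) 1 ^ 2 =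
        gapSign m (a • u + b • v) * (a'' • u + b'' • v) 1 ^ 2 := by
      simp only [gapSign, Pi.add_apply, Pi.smul_apply, smul_eq_mul]
      linear_combination m * (a'' * u 1 + b'' * v 1) * (a * u 1 + b * v 1) *
        (a * b'' - b * a'') * hδ
    have : gapSign m (a • u + b • v) * (a'' • u + b'' • v) 1 ^ 2 < 0 :=
      mul_neg_of_neg_of_pos hS (by positivity)
    rw [← e] at this
    exact neg_of_mul_neg_left this (sq_nonneg _)

/-- Of the three intersection points of a line with the curve, an even number has `gapSign < 0`.
Up to squares, the product of the three values of `y` is the value of the cubic form at the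
intersection of the line with `y = 0`, and the product of the three values of `m y - x` its value at
the intersection with `x = m y`; on both of these lines the form is definite apart from the factor
that vanishes at the centre. -/
theorem gapSign_parity (hk : 0 < k 0) {u v : Fin 3 → ℝ}
    (huv : ∀ s t : ℝ, s • u + t • v = 0 → s = 0 ∧ t = 0) {a b : Fin 3 → ℝ} {c : ℝ} (hc : c ≠ 0)
    (hN : ∀ s t : ℝ, normalCubic k q (s • u + t • v) = c * ∏ i, (s * b i - t * a i))
    {m : ℝ} (hm : m ≠ 0) (hD : normalDiscr k q m < 0) (hw : ∀ i, a i • u + b i • v ≠ 0) :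
    ((gapSign m (a 0 • u + b 0 • v) < 0 ↔ gapSign m (a 1 • u + b 1 • v) < 0) ↔
      ¬ gapSign m (a 2 • u + b 2 • v) < 0) := by
  simp only [Fin.prod_univ_three] at hN
  have hS0 (i) (h : (a i • u + b i • v) 1 = 0) : ¬ gapSign m (a i • u + b i • v) < 0 := by
    simp [gapSign, h]
  by_cases hex : ∃ i, (a i • u + b i • v) 1 = 0
  · obtain ⟨i, hi⟩ := hex
    have key {j l : Fin 3} (hN' : ∀ s t : ℝ, normalCubic k q (s • u + t • v) =
        c * ((s * b j - t * a j) * (s * b i - t * a i) * (s * b l - t * a l))) :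
        gapSign m (a j • u + b j • v) < 0 ↔ gapSign m (a l • u + b l • v) < 0 :=
      ⟨gapSign_neg_of_center hk huv hN' (hw i) hi,
        gapSign_neg_of_center hk huv (fun s t => by rw [hN']; ring) (hw i) hi⟩
    have h0 := hS0 i hi
    fin_cases i
    · have := key (j := 1) (l := 2) (fun s t => by rw [hN]; simp only [Fin.zero_eta]; ring)
      simp only [Fin.zero_eta] at h0
      tauto
    · have := key (j := 0) (l := 2) (fun s t => by rw [hN]; simp)
      simp only [Fin.mk_one] at h0
      tauto
    · have := key (j := 0) (l := 1) (fun s t => by rw [hN]; simp only [Fin.reduceFinMk]; ring)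
      simp only [Fin.reduceFinMk] at h0
      tauto
  · push Not at hex
    obtain ⟨δ, hδ⟩ : ∃ δ, δ = u 0 * v 1 - u 1 * v 0 := ⟨_, rfl⟩
    obtain ⟨ζ, hζ⟩ : ∃ ζ, ζ = v 1 * u 2 - u 1 * v 2 := ⟨_, rfl⟩
    obtain ⟨ξ, hξ⟩ : ∃ ξ, ξ = (m * v 1 - v 0) * u 2 - (m * u 1 - u 0) * v 2 := ⟨_, rfl⟩
    -- the line meets `y = 0` in `(δ : 0 : ζ)` and `x = m y` in `(m δ : δ : ξ)`
    have e1 : c * ((a 0 • u + b 0 • v) 1 * (a 1 • u + b 1 • v) 1 * (a 2 • u + b 2 • v) 1) =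
        δ * (ζ ^ 2 + k 0 * δ ^ 2) := by
      have := hN (v 1) (-u 1)
      simp only [normalCubic, Pi.add_apply, Pi.smul_apply, smul_eq_mul] at this ⊢
      rw [hδ, hζ]
      linear_combination -this
    have e2 : c * (∏ i, (m * (a i • u + b i • v) 1 - (a i • u + b i • v) 0)) =
        δ * (m * ξ ^ 2 + 2 * q * δ * ξ +
          (k 0 * m ^ 3 + k 1 * m ^ 2 + k 2 * m + k 3) * δ ^ 2) := by
      have := hN (m * v 1 - v 0) (-(m * u 1 - u 0))
      have d0 : ((m * v 1 - v 0) • u + (-(m * u 1 - u 0)) • v) 0 = m * δ := by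
        rw [hδ]; simp; ring
      have d1 : ((m * v 1 - v 0) • u + (-(m * u 1 - u 0)) • v) 1 = δ := by
        rw [hδ]; simp; ring
      have d2 : ((m * v 1 - v 0) • u + (-(m * u 1 - u 0)) • v) 2 = ξ := by
        rw [hξ]; simp; ring
      simp only [normalCubic, d0, d1, d2] at this
      simp only [Fin.prod_univ_three, Pi.add_apply, Pi.smul_apply, smul_eq_mul]
      linear_combination -this
    have hδ0 : δ ≠ 0 := by
      intro h
      rw [h, zero_mul] at e1
      exact mul_ne_zero hc (mul_ne_zero (mul_ne_zero (hex 0) (hex 1)) (hex 2)) e1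
    have hpos1 : 0 < ζ ^ 2 + k 0 * δ ^ 2 := by positivity
    have hpos2 : 0 < m * (m * ξ ^ 2 + 2 * q * δ * ξ +
          (k 0 * m ^ 3 + k 1 * m ^ 2 + k 2 * m + k 3) * δ ^ 2) := by
      have : m * (m * ξ ^ 2 + 2 * q * δ * ξ +
          (k 0 * m ^ 3 + k 1 * m ^ 2 + k 2 * m + k 3) * δ ^ 2) =
          (m * ξ + q * δ) ^ 2 + (-normalDiscr k q m) * δ ^ 2 := by
        simp only [normalDiscr]; ring
      rw [this]
      have : 0 < (-normalDiscr k q m) * δ ^ 2 := mul_pos (neg_pos.2 hD) (by positivity)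
      positivity
    have hprod : 0 < c ^ 2 * (gapSign m (a 0 • u + b 0 • v) * gapSign m (a 1 • u + b 1 • v) *
        gapSign m (a 2 • u + b 2 • v)) := by
      have : c ^ 2 * (gapSign m (a 0 • u + b 0 • v) * gapSign m (a 1 • u + b 1 • v) *
          gapSign m (a 2 • u + b 2 • v)) = m ^ 2 * δ ^ 2 * (ζ ^ 2 + k 0 * δ ^ 2) *
          (m * (m * ξ ^ 2 + 2 * q * δ * ξ +
          (k 0 * m ^ 3 + k 1 * m ^ 2 + k 2 * m + k 3) * δ ^ 2)) := by
        rw [show m ^ 2 * δ ^ 2 * (ζ ^ 2 + k 0 * δ ^ 2) * (m * (m * ξ ^ 2 + 2 * q * δ * ξ +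
          (k 0 * m ^ 3 + k 1 * m ^ 2 + k 2 * m + k 3) * δ ^ 2)) =
          m ^ 3 * (δ * (ζ ^ 2 + k 0 * δ ^ 2)) * (δ * (m * ξ ^ 2 + 2 * q * δ * ξ +
          (k 0 * m ^ 3 + k 1 * m ^ 2 + k 2 * m + k 3) * δ ^ 2)) by ring, ← e1, ← e2,
          Fin.prod_univ_three]
        simp only [gapSign]
        ring
      rw [this]
      positivity
    have hprod' := pos_of_mul_pos_right hprod (sq_nonneg c)
    generalize gapSign m (a 0 • u + b 0 • v) = S₀ at hprod'
    generalize gapSign m (a 1 • u + b 1 • v) = S₁ at hprod'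
    generalize gapSign m (a 2 • u + b 2 • v) = S₂ at hprod'
    have n0 : S₀ ≠ 0 := by rintro rfl; simp at hprod'
    have n1 : S₁ ≠ 0 := by rintro rfl; simp at hprod'
    rcases lt_or_gt_of_ne n0 with h0 | h0 <;> rcases lt_or_gt_of_ne n1 with h1 | h1
    · have := pos_of_mul_pos_right hprod' (mul_pos_of_neg_of_neg h0 h1).le
      simp [h0, h1, this.le]
    · have : S₂ < 0 := by
        by_contra! h
        exact absurd hprod' (not_lt.2
          (mul_nonpos_of_nonpos_of_nonneg (mul_neg_of_neg_of_pos h0 h1).le h))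
      simp [h0, h1.le, this]
    · have : S₂ < 0 := by
        by_contra! h
        exact absurd hprod' (not_lt.2
          (mul_nonpos_of_nonpos_of_nonneg (mul_neg_of_pos_of_neg h0 h1).le h))
      simp [h0.le, h1, this]
    · have := pos_of_mul_pos_right hprod' (mul_pos h0 h1).le
      simp only [not_lt.2 h0.le, not_lt.2 h1.le, not_lt.2 this.le, not_false_eq_true]

end

/-! ### The splitting of the real points into two ovals -/

theorem mk_mem_realPoints {F : MvPolynomial (Fin 3) ℝ} (hF : F.IsHomogeneous 3) {v : Fin 3 → ℝ}
    (hv : v ≠ 0) : Projectivization.mk ℝ v hv ∈ realPoints F ↔ eval v F = 0 := by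
  constructor
  · intro h
    exact h v (by rw [Projectivization.submodule_mk]; exact Submodule.mem_span_singleton_self v)
  · intro h w hw
    rw [Projectivization.submodule_mk] at hw
    obtain ⟨c, rfl⟩ := Submodule.mem_span_singleton.1 hw
    obtain ⟨k, q, l, n, rfl⟩ := exists_eq_ternaryCubic hF
    rw [eval_ternaryCubic] at h ⊢
    simp only [Pi.smul_apply, smul_eq_mul]
    linear_combination c ^ 3 * h

theorem mk_mem_lineAtInfinity {v : Fin 3 → ℝ} (hv : v ≠ 0) :
    Projectivization.mk ℝ v hv ∈ lineAtInfinity ↔ v 2 = 0 := by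
  constructor
  · intro h
    exact h v (by rw [Projectivization.submodule_mk]; exact Submodule.mem_span_singleton_self v)
  · intro h w hw
    rw [Projectivization.submodule_mk] at hw
    obtain ⟨c, rfl⟩ := Submodule.mem_span_singleton.1 hw
    simp [h]

/-- The real points of `F = 0` are the disjoint union of two nonempty connected sets: `A`,
contractible in `ℝℙ²`, which every line that meets the curve in three real points meets an even
number of times, and `B`, which is not contractible. -/
structure IsOvalSplitting (F : MvPolynomial (Fin 3) ℝ) (A B : Set RP2) : Prop where
  realPoints_eq : realPoints F = A ∪ B
  disjoint : Disjoint A B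
  nonempty_left : A.Nonempty
  nonempty_right : B.Nonempty
  preconnected_left : IsPreconnected A
  preconnected_right : IsPreconnected B
  contractible : IsContractibleInRP2 A
  not_contractible : ¬ IsContractibleInRP2 B
  parity : ∀ p q r, LineMeetsIn F p q r → ((p ∈ A ↔ q ∈ A) ↔ r ∉ A)

section
variable {k : Fin 4 → ℝ} {q : ℝ} {M : Matrix (Fin 3) (Fin 3) ℝ}

theorem normalCubic_smul (c : ℝ) (w : Fin 3 → ℝ) :
    normalCubic k q (c • w) = c ^ 3 * normalCubic k q w := by
  simp [normalCubic]; ring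

theorem eq_smul_affine {w : Fin 3 → ℝ} (h : w 1 ≠ 0) : w = w 1 • ![w 0 / w 1, 1, w 2 / w 1] := by
  ext i
  fin_cases i <;> simp <;> field_simp

theorem mem_normalCenter (hk : 0 < k 0) (hM : M.det ≠ 0) {w : Fin 3 → ℝ}
    (hw : normalCubic k q w = 0) (h0 : M *ᵥ w ≠ 0) (h1 : w 1 = 0) :
    Projectivization.mk ℝ _ h0 ∈ normalCenter M := by
  have hw0 := apply_zero_of_apply_one hk hw h1
  refine ⟨mulVec_ne_zero_of_det_ne_zero hM (vec_ne_zero_of_apply (i := 2) (by simp)),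
    mk_mulVec_eq_of_smul _ _ (w 2) ?_⟩
  ext i
  fin_cases i <;> simp [hw0, h1]

theorem exists_affine {w : Fin 3 → ℝ} (hM : M.det ≠ 0)
    (hw : normalCubic k q w = 0) (h0 : M *ᵥ w ≠ 0) (h1 : w 1 ≠ 0) :
    ∃ x z, normalCubic k q ![x, 1, z] = 0 ∧ 0 ≤ normalDiscr k q x ∧ w = w 1 • ![x, 1, z] ∧
      ∃ h : M *ᵥ ![x, 1, z] ≠ 0, Projectivization.mk ℝ _ h0 = Projectivization.mk ℝ _ h := by
  have hwe := eq_smul_affine h1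
  have hN : normalCubic k q ![w 0 / w 1, 1, w 2 / w 1] = 0 := by
    rw [hwe, normalCubic_smul] at hw
    exact (mul_eq_zero.1 hw).resolve_left (pow_ne_zero _ h1)
  exact ⟨_, _, hN, by rw [← sq_eq_normalDiscr hN]; positivity, hwe,
    mulVec_ne_zero_of_det_ne_zero hM (vec_ne_zero_of_apply (i := 1) (by simp)),
    mk_mulVec_eq_of_smul _ _ _ hwe⟩

theorem exists_mulVec_eq (hM : M.det ≠ 0) (v : Fin 3 → ℝ) : ∃ w, M *ᵥ w = v :=
  ⟨M⁻¹ *ᵥ v, by rw [mulVec_mulVec, mul_nonsing_inv _ (isUnit_iff_ne_zero.2 hM), one_mulVec]⟩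

theorem eq_smul_of_mk_mulVec_eq (hM : M.det ≠ 0) {u v : Fin 3 → ℝ} {hu : M *ᵥ u ≠ 0}
    {hv : M *ᵥ v ≠ 0} (h : (Projectivization.mk ℝ _ hu : RP2) = Projectivization.mk ℝ _ hv) :
    ∃ c : ℝ, c ≠ 0 ∧ u = c • v := by
  obtain ⟨c, hc⟩ := (Projectivization.mk_eq_mk_iff' _ _ _ _ _).1 h
  refine ⟨c, ?_, ?_⟩
  · rintro rfl
    exact hu (by rw [← hc, zero_smul])
  · rw [← mulVec_smul] at hc
    exact (mulVec_injective_of_isUnit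
      ((isUnit_iff_isUnit_det M).2 (isUnit_iff_ne_zero.2 hM)) hc).symm

theorem mk_mem_normalSheet_iff (hM : M.det ≠ 0) {a b c d m : ℝ}
    (hD : ∀ x, 0 ≤ normalDiscr k q x → x ∈ Set.Icc a b ∨ x ∈ Set.Icc c d)
    (h1 : ∀ x ∈ Set.Icc a b, 0 < m * (m - x)) (h2 : ∀ x ∈ Set.Icc c d, m * (m - x) < 0)
    {w : Fin 3 → ℝ} (hw : normalCubic k q w = 0) (h0 : M *ᵥ w ≠ 0) :
    Projectivization.mk ℝ _ h0 ∈ normalSheet M k q c d ↔ gapSign m w < 0 := by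
  have hg (x z : ℝ) : gapSign m ![x, 1, z] = m * (m - x) := by simp [gapSign]
  constructor
  · rintro ⟨x, hx, z, -, h, heq⟩
    obtain ⟨c, hc, rfl⟩ := eq_smul_of_mk_mulVec_eq hM heq
    rw [gapSign_smul, hg]
    exact mul_neg_of_pos_of_neg (by positivity) (h2 x hx)
  · intro hS
    have hw1 : w 1 ≠ 0 := by
      intro h
      simp [gapSign, h] at hS
    obtain ⟨x, z, hN, hDx, hwe, h, heq⟩ := exists_affine hM hw h0 hw1
    rcases hD x hDx with hx | hx
    · rw [hwe, gapSign_smul, hg] at hS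
      have := mul_pos (pow_pos (abs_pos.2 hw1) 2) (h1 x hx)
      rw [sq_abs] at this
      linarith
    · exact ⟨x, hx, z, hN, h, heq⟩

theorem eval_mulVec_of_linSubst {F : MvPolynomial (Fin 3) ℝ}
    (hF : linSubst M F = ternaryCubic k ![0, 0, q] ![1, 0] 0) (w : Fin 3 → ℝ) :
    eval (M *ᵥ w) F = normalCubic k q w := by
  rw [← eval_linSubst, hF, eval_ternaryCubic]
  simp [normalCubic]
  ring

theorem normalSheet_union_center (hM : M.det ≠ 0) {a b : ℝ} (hab : a < b)
    (h0 : 0 ∈ Set.Icc a b) (hq : 0 ≤ q) (hk3 : q = 0 → k 3 ≠ 0)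
    (ha : normalDiscr k q a = 0) (hb : normalDiscr k q b = 0)
    (hD : ∀ x ∈ Set.Ioo a b, 0 < normalDiscr k q x) :
    IsPreconnected (normalSheet M k q a b ∪ normalCenter M) ∧
      ¬ IsContractibleInRP2 (normalSheet M k q a b ∪ normalCenter M) := by
  rcases hq.eq_or_lt with rfl | hq
  · exact normalSheet_union_center_of_zero hM (hk3 rfl) hab h0 ha hb hD
  · refine normalSheet_union_center_of_pos hM hq hab h0 ha hb fun x hx => ?_
    rcases eq_or_ne x a with rfl | hxa
    · exact ha.ge
    rcases eq_or_ne x b with rfl | hxb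
    · exact hb.ge
    exact (hD x ⟨lt_of_le_of_ne hx.1 hxa.symm, lt_of_le_of_ne hx.2 hxb⟩).le

/-- If the discriminant of the normal form is nonnegative on one interval only, the real points are
connected. Otherwise the oval `A` lies over the interval that avoids `0` and `B` is the rest. -/
theorem IsSmoothRealCubic.isPreconnected_or_splitting {F : MvPolynomial (Fin 3) ℝ}
    (hF : IsSmoothRealCubic F) (hne : (realPoints F).Nonempty) :
    IsPreconnected (realPoints F) ∨ ∃ A B, IsOvalSplitting F A B := by
  obtain ⟨T, hT⟩ := hne
  rw [← T.mk_rep, mk_mem_realPoints hF.homogeneous] at hT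
  obtain ⟨M, hM, k, q, hk, hq, hG⟩ := hF.exists_normalForm T.rep_nonzero hT
  have hS := hF.comp_linSubst hM
  rw [hG] at hS
  have hev := eval_mulVec_of_linSubst hG
  have hk3 : q = 0 → k 3 ≠ 0 := by
    rintro rfl h
    have := hS.discrim_simple 0 (by simp)
    simp [h] at this
  have hmk (w : Fin 3 → ℝ) (h0 : M *ᵥ w ≠ 0) :
      Projectivization.mk ℝ _ h0 ∈ realPoints F ↔ normalCubic k q w = 0 := by
    rw [mk_mem_realPoints hF.homogeneous, hev]
  have hsheet (a b : ℝ) : normalSheet M k q a b ⊆ realPoints F := by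
    rintro p ⟨x, -, z, hz, h, rfl⟩
    exact (hmk _ _).2 hz
  have hcenter : normalCenter M ⊆ realPoints F := by
    rintro p ⟨h, rfl⟩
    rw [hmk]
    simp [normalCubic]
  have hpt (p : RP2) : ∃ w, ∃ h : M *ᵥ w ≠ 0, p = Projectivization.mk ℝ _ h := by
    obtain ⟨w, hw⟩ := exists_mulVec_eq hM p.rep
    have h : M *ᵥ w ≠ 0 := by rw [hw]; exact p.rep_nonzero
    refine ⟨w, h, ?_⟩
    simp only [hw, p.mk_rep]
  obtain ⟨a, b, hab, h0, ha, hb, hI, hor⟩ :=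
    quartic_nonneg_set hk (sq_nonneg q) hS.discrim_simple (f := normalDiscr k q) (fun x => by
      simp only [normalDiscr]; ring)
  obtain ⟨hconn, hnot⟩ := normalSheet_union_center hM hab h0 hq hk3 ha hb hI
  rcases hor with hD | ⟨c, d, hcd, hgap, hc, hJ, hD⟩
  · left
    convert hconn using 1
    refine Set.Subset.antisymm ?_ (Set.union_subset (hsheet a b) hcenter)
    intro p hp
    obtain ⟨w, h, rfl⟩ := hpt p
    have hw := (hmk w h).1 hp
    by_cases hw1 : w 1 = 0
    · exact .inr (mem_normalCenter hk hM hw h hw1)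
    · obtain ⟨x, z, hN, hDx, -, h', heq⟩ := exists_affine hM hw h hw1
      exact .inl ⟨x, hD x hDx, z, hN, h', heq⟩
  · right
    -- a parameter in the gap between the two intervals
    obtain ⟨m, h1, h2⟩ : ∃ m : ℝ, (∀ x ∈ Set.Icc a b, 0 < m * (m - x)) ∧
        ∀ x ∈ Set.Icc c d, m * (m - x) < 0 := by
      rcases hgap with h | h
      · refine ⟨(b + c) / 2, fun x hx => ?_, fun x hx => ?_⟩
        · exact mul_pos (by linarith [h0.2]) (by linarith [hx.2])
        · exact mul_neg_of_pos_of_neg (by linarith [h0.2]) (by linarith [hx.1])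
      · refine ⟨(d + a) / 2, fun x hx => ?_, fun x hx => ?_⟩
        · exact mul_pos_of_neg_of_neg (by linarith [h0.1]) (by linarith [hx.1])
        · exact mul_neg_of_neg_of_pos (by linarith [h0.1]) (by linarith [hx.2])
    have hm : m ≠ 0 := by
      rintro rfl
      simpa using h1 0 h0
    have hDm : normalDiscr k q m < 0 := by
      by_contra! h
      rcases hD m h with h | h
      · simpa using h1 m h
      · simpa using h2 m h
    have hmem {w : Fin 3 → ℝ} (hw : normalCubic k q w = 0) (h : M *ᵥ w ≠ 0) :=
      mk_mem_normalSheet_iff hM hD h1 h2 hw h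
    have h0J : 0 ∉ Set.Icc c d := fun h => (h1 0 h0).not_gt (h2 0 h)
    obtain ⟨hA, hAne⟩ := isPreconnected_normalSheet hM hcd h0J hc hJ
    refine ⟨normalSheet M k q c d, normalSheet M k q a b ∪ normalCenter M, ?_, ?_, hAne, ?_, hA,
      hconn, isContractibleInRP2_normalSheet hM, hnot, ?_⟩
    · refine Set.Subset.antisymm ?_
        (Set.union_subset (hsheet c d) (Set.union_subset (hsheet a b) hcenter))
      intro p hp
      obtain ⟨w, h, rfl⟩ := hpt p
      have hw := (hmk w h).1 hp
      by_cases hw1 : w 1 = 0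
      · exact .inr (.inr (mem_normalCenter hk hM hw h hw1))
      · obtain ⟨x, z, hN, hDx, -, h', heq⟩ := exists_affine hM hw h hw1
        rcases hD x hDx with hx | hx
        · exact .inr (.inl ⟨x, hx, z, hN, h', heq⟩)
        · exact .inl ⟨x, hx, z, hN, h', heq⟩
    · rw [Set.disjoint_right]
      rintro p (⟨x, hx, z, hz, h, rfl⟩ | ⟨h, rfl⟩)
      · rw [hmem hz]
        have := h1 x hx
        simp only [gapSign]
        simp
        linarith
      · rw [hmem (by simp [normalCubic])]
        simp [gapSign]
    · exact ⟨_, .inr ⟨mulVec_ne_zero_of_det_ne_zero hM (vec_ne_zero_of_apply (i := 2) (by simp)),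
        rfl⟩⟩
    · rintro p₀ p₁ p₂ ⟨u, v, huv, a', b', hpts, e, he, hFe⟩
      obtain ⟨u, rfl⟩ := exists_mulVec_eq hM u
      obtain ⟨v, rfl⟩ := exists_mulVec_eq hM v
      have hlin (s t : ℝ) : s • M *ᵥ u + t • M *ᵥ v = M *ᵥ (s • u + t • v) := by
        rw [mulVec_add, mulVec_smul, mulVec_smul]
      have hind (s t : ℝ) (h : s • u + t • v = 0) : s = 0 ∧ t = 0 := by
        refine LinearIndependent.pair_iff.1 huv s t ?_
        rw [hlin, h, mulVec_zero]
      have hN (s t : ℝ) : normalCubic k q (s • u + t • v) = e * ∏ i, (s * b' i - t * a' i) := by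
        rw [← hFe, hlin, hev]
      have hMw (i) : M *ᵥ (a' i • u + b' i • v) ≠ 0 := by
        rw [← hlin]; exact (hpts i).1
      have hw (i) : a' i • u + b' i • v ≠ 0 := by
        intro h
        apply hMw i
        rw [h, mulVec_zero]
      have hN0 (i) : normalCubic k q (a' i • u + b' i • v) = 0 := by
        rw [hN, Finset.prod_eq_zero (Finset.mem_univ i) (by ring), mul_zero]
      have hp (i) : (![p₀, p₁, p₂] : Fin 3 → RP2) i ∈ normalSheet M k q c d ↔
          gapSign m (a' i • u + b' i • v) < 0 := by
        obtain ⟨h, heq⟩ := hpts i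
        rw [heq, ← hmem (hN0 i) (hMw i)]
        simp only [hlin]
      have := gapSign_parity hk hind he hN hm hDm hw
      rw [← hp, ← hp, ← hp] at this
      exact this

end

/-! ### The line at infinity and the hexagon -/

/-- A set that is the union of two connected sets but is not connected has these two sets as its
components. -/
theorem IsOvalSplitting.ovals_eq {F : MvPolynomial (Fin 3) ℝ} {A B : Set RP2}
    (h : IsOvalSplitting F A B) (hn : ¬ IsPreconnected (realPoints F)) : ovals F = {A, B} := by
  have key {X Y : Set RP2} (hXY : realPoints F = X ∪ Y) (hX : IsPreconnected X)
      (hY : IsPreconnected Y) {p : RP2} (hp : p ∈ X) :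
      connectedComponentIn (realPoints F) p = X := by
    have hXs : X ⊆ realPoints F := hXY ▸ Set.subset_union_left
    have hYs : Y ⊆ realPoints F := hXY ▸ Set.subset_union_right
    refine Set.Subset.antisymm ?_ (hX.subset_connectedComponentIn hp hXs)
    intro y hy
    by_contra hyX
    have hyY : y ∈ Y := ((hXY ▸ connectedComponentIn_subset _ _ hy : y ∈ X ∪ Y)).resolve_left hyX
    have h1 := hX.subset_connectedComponentIn hp hXs
    have h2 := hY.subset_connectedComponentIn hyY hYs
    rw [← connectedComponentIn_eq hy] at h2
    apply hn
    have := isPreconnected_connectedComponentIn (F := realPoints F) (x := p)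
    rwa [Set.Subset.antisymm (connectedComponentIn_subset _ _)
      (hXY.subset.trans (Set.union_subset h1 h2))] at this
  have hl {p} (hp : p ∈ A) := key h.realPoints_eq h.preconnected_left h.preconnected_right hp
  have hr {p} (hp : p ∈ B) := key (h.realPoints_eq.trans (Set.union_comm _ _))
    h.preconnected_right h.preconnected_left hp
  ext O
  constructor
  · rintro ⟨p, hp, rfl⟩
    rw [h.realPoints_eq] at hp
    rcases hp with hp | hp
    · exact .inl (hl hp)
    · exact .inr (hr hp)
  · rintro (rfl | rfl)
    · obtain ⟨p, hp⟩ := h.nonempty_left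
      exact ⟨p, h.realPoints_eq ▸ .inl hp, (hl hp).symm⟩
    · obtain ⟨p, hp⟩ := h.nonempty_right
      exact ⟨p, h.realPoints_eq ▸ .inr hp, (hr hp).symm⟩

theorem det_rep_ne_zero {p p' : RP2} (hne : p ≠ p') (hp : p ∈ lineAtInfinity)
    (hp' : p' ∈ lineAtInfinity) : p.rep 0 * p'.rep 1 - p.rep 1 * p'.rep 0 ≠ 0 := by
  rw [← p.mk_rep, mk_mem_lineAtInfinity] at hp
  rw [← p'.mk_rep, mk_mem_lineAtInfinity] at hp'
  have hind := Projectivization.independent_iff.1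
    ((Projectivization.independent_pair_iff_ne _ _).2 hne)
  have hcomp : Projectivization.rep ∘ ![p, p'] = ![p.rep, p'.rep] := by
    ext i : 1
    fin_cases i <;> rfl
  rw [hcomp, LinearIndependent.pair_iff] at hind
  intro h
  have h1 := hind (p'.rep 1) (-p.rep 1) (by
    ext i
    fin_cases i <;> simp [hp, hp']
    · linear_combination h
    · ring)
  have h2 := hind (p'.rep 0) (-p.rep 0) (by
    ext i
    fin_cases i <;> simp [hp, hp']
    · ring
    · linear_combination -h)
  apply p.rep_nonzero
  ext i
  fin_cases i
  · simpa using h2.2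
  · simpa using h1.2
  · exact hp

/-- A smooth cubic meets the line at infinity exactly in its three given real points, each of them
once. -/
theorem IsSmoothRealCubic.lineMeetsIn_infinity {F : MvPolynomial (Fin 3) ℝ}
    (hF : IsSmoothRealCubic F) {inf : Fin 3 → RP2} (hinj : Function.Injective inf)
    (hinf : ∀ i, inf i ∈ realPoints F ∩ lineAtInfinity) :
    LineMeetsIn F (inf 0) (inf 1) (inf 2) ∧
      ∀ p ∈ realPoints F ∩ lineAtInfinity, ∃ i, p = inf i := by
  have hz (i) : (inf i).rep 2 = 0 := by
    have := (hinf i).2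
    rwa [← (inf i).mk_rep, mk_mem_lineAtInfinity] at this
  have hev (i) : eval (inf i).rep F = 0 := by
    have := (hinf i).1
    rwa [← (inf i).mk_rep, mk_mem_realPoints hF.homogeneous] at this
  have hdet (i j) (h : i ≠ j) := det_rep_ne_zero (hinj.ne h) (hinf i).2 (hinf j).2
  have h01 := hdet 0 1 (by decide)
  have h02 := hdet 0 2 (by decide)
  have h21 := hdet 2 1 (by decide)
  have hr0 := hz 0
  have hr1 := hz 1
  have hr2 := hz 2
  have he0 := hev 0
  have he1 := hev 1
  have he2 := hev 2
  obtain ⟨u, hu⟩ : ∃ u, u = (inf 0).rep := ⟨_, rfl⟩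
  obtain ⟨v, hv⟩ : ∃ v, v = (inf 1).rep := ⟨_, rfl⟩
  obtain ⟨w, hw⟩ : ∃ w, w = (inf 2).rep := ⟨_, rfl⟩
  rw [← hu] at h01 h02 hr0 he0
  rw [← hv] at h01 h21 hr1 he1
  rw [← hw] at h02 h21 hr2 he2
  set δ := u 0 * v 1 - u 1 * v 0 with hδ
  obtain ⟨a, ha⟩ : ∃ a, a = (w 0 * v 1 - w 1 * v 0) / δ := ⟨_, rfl⟩
  obtain ⟨b, hb⟩ : ∃ b, b = (u 0 * w 1 - u 1 * w 0) / δ := ⟨_, rfl⟩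
  have ha0 : a ≠ 0 := ha ▸ div_ne_zero h21 h01
  have hb0 : b ≠ 0 := hb ▸ div_ne_zero h02 h01
  -- `u, v` span the line at infinity
  have hspan (y : Fin 3 → ℝ) (hy : y 2 = 0) :
      y = ((y 0 * v 1 - y 1 * v 0) / δ) • u + ((u 0 * y 1 - u 1 * y 0) / δ) • v := by
    ext i
    fin_cases i <;> simp [hy, hr0, hr1] <;> field_simp <;> rw [hδ] <;> ring
  have hwe : w = a • u + b • v := ha ▸ hb ▸ hspan w hr2
  have hM : (!![u 0, v 0, 0; u 1, v 1, 0; 0, 0, 1] : Matrix (Fin 3) (Fin 3) ℝ).det ≠ 0 := by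
    rw [show (!![u 0, v 0, 0; u 1, v 1, 0; 0, 0, 1] : Matrix (Fin 3) (Fin 3) ℝ).det = δ by
      simp [det_fin_three, hδ]; ring]
    exact h01
  have hS := hF.comp_linSubst hM
  obtain ⟨k, q, l, n, hG⟩ := exists_eq_ternaryCubic hS.homogeneous
  rw [hG] at hS
  have hk := hS.restrict_ne_zero
  have hline (s t : ℝ) : eval (s • u + t • v) F =
      k 0 * s ^ 3 + k 1 * s ^ 2 * t + k 2 * s * t ^ 2 + k 3 * t ^ 3 := by
    have : s • u + t • v = !![u 0, v 0, 0; u 1, v 1, 0; 0, 0, 1] *ᵥ ![s, t, 0] := by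
      ext i
      fin_cases i <;> simp [hr0, hr1]
    rw [this, ← eval_linSubst, hG, eval_ternaryCubic]
    simp
  have hk0 : k 0 = 0 := by simpa [he0] using (hline 1 0).symm
  have hk3 : k 3 = 0 := by simpa [he1] using (hline 0 1).symm
  have hk12 : k 1 * a + k 2 * b = 0 := by
    have := hline a b
    rw [← hwe, he2, hk0, hk3] at this
    apply mul_left_cancel₀ (mul_ne_zero ha0 hb0)
    linear_combination -this
  have hk1 : k 1 ≠ 0 := by
    intro h
    rw [h, zero_mul, zero_add] at hk12
    have h2 := (mul_eq_zero.1 hk12).resolve_right hb0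
    exact hk (by ext i; fin_cases i <;> simp [*])
  have hform (s t : ℝ) : eval (s • u + t • v) F = (k 1 / b) * (s * t * (s * b - t * a)) := by
    rw [hline, hk0, hk3]
    field_simp
    linear_combination s * t ^ 2 * hk12
  constructor
  · refine ⟨u, v, ?_, ![1, 0, a], ![0, 1, b], ?_, -(k 1 / b), neg_ne_zero.2 (div_ne_zero hk1 hb0),
      fun s t => ?_⟩
    · rw [LinearIndependent.pair_iff]
      intro s t h
      have e0 := congrFun h 0
      have e1 := congrFun h 1
      simp only [Pi.add_apply, Pi.smul_apply, smul_eq_mul, Pi.zero_apply] at e0 e1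
      constructor <;> apply mul_right_cancel₀ h01 <;> rw [hδ]
      · linear_combination v 1 * e0 - v 0 * e1
      · linear_combination u 0 * e1 - u 1 * e0
    · intro i
      fin_cases i
      · refine ⟨by simp [hu, Projectivization.rep_nonzero], ?_⟩
        simp [hu, Projectivization.mk_rep]
      · refine ⟨by simp [hv, Projectivization.rep_nonzero], ?_⟩
        simp [hv, Projectivization.mk_rep]
      · refine ⟨by simp [← hwe, hw, Projectivization.rep_nonzero], ?_⟩
        simp [← hwe, hw, Projectivization.mk_rep]
    · rw [hform, Fin.prod_univ_three]
      simp only [cons_val_zero, cons_val_one, cons_val_two, head_cons, tail_cons]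
      ring
  · rintro p ⟨hp, hp'⟩
    rw [← p.mk_rep, mk_mem_lineAtInfinity] at hp'
    rw [← p.mk_rep, mk_mem_realPoints hF.homogeneous] at hp
    have hpe := hspan p.rep hp'
    generalize (p.rep 0 * v 1 - p.rep 1 * v 0) / δ = s at hpe
    generalize (u 0 * p.rep 1 - u 1 * p.rep 0) / δ = t at hpe
    rw [hpe, hform] at hp
    have hp2 := (mul_eq_zero.1 hp).resolve_left (div_ne_zero hk1 hb0)
    have hmk (i) (c : ℝ) (h : p.rep = c • (inf i).rep) : p = inf i := by
      rw [← p.mk_rep, ← (inf i).mk_rep]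
      exact (Projectivization.mk_eq_mk_iff' _ _ _ _ _).2 ⟨c, h.symm⟩
    rcases mul_eq_zero.1 hp2 with h | h
    · rcases mul_eq_zero.1 h with rfl | rfl
      · exact ⟨1, hmk 1 t (by rw [hpe, hv]; simp)⟩
      · exact ⟨0, hmk 0 s (by rw [hpe, hu]; simp)⟩
    · refine ⟨2, hmk 2 (s / a) ?_⟩
      rw [← hw, hwe, hpe, smul_add, smul_smul, smul_smul, div_mul_cancel₀ _ ha0]
      congr 2
      field_simp
      linear_combination -h

open Classical in
theorem ncard_setOf_fin_three (p : Fin 3 → Prop) :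
    {i | p i}.ncard = (if p 0 then 1 else 0) + (if p 1 then 1 else 0) + (if p 2 then 1 else 0) := by
  rw [Set.ncard_eq_toFinset_card', Set.toFinset_ofPred, Finset.card_filter, Fin.sum_univ_three]

/-- By parity, the vertices `P i` and `Q j` lie on the same oval if and only if the third point
`inf l` lies on `B`; this determines the distribution of the six vertices up to exchanging the two
ovals. -/
theorem IsOvalSplitting.hasType {F : MvPolynomial (Fin 3) ℝ} {A B : Set RP2}
    (h : IsOvalSplitting F A B) (hn : ¬ IsPreconnected (realPoints F))
    {inf P Q : Fin 3 → RP2} (hH : IsRegularlyInscribed F inf P Q) :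
    ((∀ i, inf i ∉ A) → HasType F P Q 0 6 ∨ HasType F P Q 6 0) ∧
    (∀ i, (∀ j, inf j ∈ A ↔ j ≠ i) → HasType F P Q 4 2 ∨ HasType F P Q 2 4) := by
  have hB {p} (hp : p ∈ realPoints F) : p ∈ B ↔ ¬ p ∈ A := by
    rw [h.realPoints_eq] at hp
    exact ⟨fun h1 h2 => Set.disjoint_left.1 h.disjoint h2 h1, fun h1 => hp.resolve_left h1⟩
  have htype {m n : ℕ} (hm : vertexCount P Q A = m) (hn' : vertexCount P Q B = n) :
      HasType F P Q m n :=
    ⟨A, B, h.ovals_eq hn, h.contractible, h.not_contractible, hm, hn'⟩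
  have hpar (i j l : Fin 3) (hd : ∃ σ : Equiv.Perm (Fin 3), σ 0 = i ∧ σ 1 = j ∧ σ 2 = l) :
      (P i ∈ A ↔ Q j ∈ A) ↔ inf l ∉ A := by
    obtain ⟨σ, rfl, rfl, rfl⟩ := hd
    exact h.parity _ _ _ (hH.third σ)
  have p012 := hpar 0 1 2 (by decide)
  have p021 := hpar 0 2 1 (by decide)
  have p102 := hpar 1 0 2 (by decide)
  have p120 := hpar 1 2 0 (by decide)
  have p201 := hpar 2 0 1 (by decide)
  have p210 := hpar 2 1 0 (by decide)
  have hcB : vertexCount P Q B = {i | ¬ P i ∈ A}.ncard + {i | ¬ Q i ∈ A}.ncard := by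
    simp only [vertexCount, hB (hH.mem_P _), hB (hH.mem_Q _)]
  have hcA : vertexCount P Q A = {i | P i ∈ A}.ncard + {i | Q i ∈ A}.ncard := rfl
  rw [ncard_setOf_fin_three, ncard_setOf_fin_three] at hcA hcB
  refine ⟨fun hi => ?_, fun i hi => ?_⟩
  · simp only [hi, not_false_eq_true, iff_true] at p012 p021 p102 p120 p201 p210
    by_cases h0 : P 0 ∈ A
    · right
      apply htype <;> simp_all
    · left
      apply htype <;> simp_all
  · simp only [hi] at p012 p021 p102 p120 p201 p210
    by_cases h0 : P 0 ∈ A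
    · fin_cases i <;> simp [h0] at p012 p021 p102 p120 p201 p210
      · right; apply htype <;> simp_all
      · left; apply htype <;> simp_all
      · left; apply htype <;> simp_all
    · fin_cases i <;> simp [h0] at p012 p021 p102 p120 p201 p210
      · left; apply htype <;> simp_all
      · right; apply htype <;> simp_all
      · right; apply htype <;> simp_all

end

theorem mainTheorem8 (F : MvPolynomial (Fin 3) ℝ) (hF : IsSmoothRealCubic F)
    (inf : Fin 3 → RP2) (hinj : Function.Injective inf)
    (hinf : ∀ i, inf i ∈ realPoints F ∩ lineAtInfinity)
    (P Q : Fin 3 → RP2) (hH : IsRegularlyInscribed F inf P Q) :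
    ((∃ O ∈ ovals F, IsBoundedOval O) → HasType F P Q 0 6 ∨ HasType F P Q 6 0) ∧
    (((ovals F).ncard = 2 ∧ ∀ O ∈ ovals F, ¬ IsBoundedOval O) →
      HasType F P Q 4 2 ∨ HasType F P Q 2 4) := by
  obtain ⟨hline, hall⟩ := hF.lineMeetsIn_infinity hinj hinf
  by_cases hn : IsPreconnected (realPoints F)
  · have hcomp {O} (hO : O ∈ ovals F) : O = realPoints F := by
      obtain ⟨p, hp, rfl⟩ := hO
      exact hn.connectedComponentIn hp
    constructor
    · rintro ⟨O, hO, hb⟩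
      rw [hcomp hO] at hb
      exact absurd (hinf 0).2 (Set.disjoint_left.1 hb (hinf 0).1)
    · rintro ⟨hcard, -⟩
      obtain ⟨X, Y, hXY, hov⟩ := Set.ncard_eq_two.1 hcard
      exact absurd ((hcomp (hov ▸ .inl rfl)).trans (hcomp (hov ▸ .inr rfl)).symm) hXY
  · obtain ⟨A, B, h⟩ := (hF.isPreconnected_or_splitting ⟨_, (hinf 0).1⟩).resolve_left hn
    obtain ⟨t1, t2⟩ := h.hasType hn hH
    have hpar := h.parity _ _ _ hline
    have hov := h.ovals_eq hn
    constructor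
    · rintro ⟨O, hO, hb⟩
      apply t1
      have hO' : ∀ i, inf i ∉ O := fun i hi => Set.disjoint_left.1 hb hi (hinf i).2
      rw [hov] at hO
      rcases hO with rfl | rfl
      · exact hO'
      · have hA (i) : inf i ∈ A := by
          have := (hinf i).1
          rw [h.realPoints_eq] at this
          exact this.resolve_right (hO' i)
        simp [hA] at hpar
    · rintro ⟨-, hb⟩
      obtain ⟨p, hpA, hp⟩ := Set.not_disjoint_iff.1 (hb A (hov ▸ .inl rfl))
      obtain ⟨i, rfl⟩ := hall p ⟨h.realPoints_eq ▸ .inl hpA, hp⟩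
      have : ∃ i, ∀ j, inf j ∈ A ↔ j ≠ i := by
        by_cases h0 : inf 0 ∈ A <;> by_cases h1 : inf 1 ∈ A <;> by_cases h2 : inf 2 ∈ A <;>
          simp [h0, h1, h2] at hpar
        · exact ⟨2, fun j => by fin_cases j <;> simp [*]⟩
        · exact ⟨1, fun j => by fin_cases j <;> simp [*]⟩
        · exact ⟨0, fun j => by fin_cases j <;> simp [*]⟩
        · fin_cases i <;> contradiction
      obtain ⟨i, hi⟩ := this
      exact t2 i hi
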